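/- Fix $d\ge 0$, a probability space $(\mathsf Z,\mathcal Z,\mathbb P_\xi)$, a function $f:\mathbb R^d\to\mathbb R$ with minimizer $\theta^\star$, and a measurable stochastic gradient $\nabla F:\mathbb R^d\times\mathsf Z\to\mathbb R^d$ (no property of $\nabla F$ is used beyond those listed here). Assume: (A1) $f$ is $C^1$ and $\frac{\mu}{2}\|\theta-\theta'\|^2\le f(\theta)-f(\theta')-\langle\nabla f(\theta'),\theta-\theta'\rangle$ for all $\theta,\theta'$, for some $\mu>0$; (A2) $f$ is $C^4$, $\nabla f$ is $L_2$-Lipschitz, and $\|\nabla^3 f\|\le L_3$, $\|\nabla^4 f\|\le L_4$ everywhere (operator norm of multilinear forms), with $L_2,L_3,L_4\ge 0$; (A3) $\mathsf E_{\xi\sim\mathbb P_\xi}[\nabla F(\theta,\xi)]=\nabla f(\theta)$ for all $\theta$; $\mathsf E^{1/p}[\|\nabla F(\theta^\star,\xi)\|^p]\le\tau_p$ for $p\in\{2,6\}$, with $\tau_2,\tau_6\ge 0$; and for some $L_1>0$, all $q\in\{2,\dots,6\}$ and all $\theta_1,\theta_2$, $$\mathsf E\|\nabla F(\theta_1,\xi)-\nabla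 F(\theta_2,\xi)\|^q\le L_1^{q-1}\|\theta_1-\theta_2\|^{q-2}\langle\nabla f(\theta_1)-\nabla f(\theta_2),\theta_1-\theta_2\rangle .$$ Put $L=\max(L_1,L_2,L_3,L_4)$. For $\gamma>0$ let $\theta^{(\gamma)}_{k+1}=\theta^{(\gamma)}_k-\gamma\nabla F(\theta^{(\gamma)}_k,\xi_{k+1})$, where $\theta^{(\gamma)}_0=\theta_0\sim\nu$, the $\xi_k$ are i.i.d. with law $\mathbb P_\xi$, and $\theta_0$ is independent of $(\xi_k)_k$; write $\mathsf E_\nu$ for the expectation, $\bar\theta^{(\gamma)}_n=\frac1n\sum_{k=n+1}^{2n}\theta^{(\gamma)}_k$, and $Q_\gamma(\theta,A)=\mathbb P_\xi(\{z:\theta-\gamma\nabla F(\theta,z)\in A\})$ for the Markov kernel of the chain. Assume finally that (C6) there are $C_6,D_6\ge 2$ such that for every $\gamma\in(0,1/(LD_6)]$, every probability measure $\nu$ on $\mathbb R^d$ and every $k\ge 0$, $$\mathsf E_\nu^{1/3}\|\theta^{(\gamma)}_k-\theta^\star\|^6\le(1-\gamma\mu)^k\,\mathsf E_\nu^{1/3}\|\theta_0-\theta^\star\|^6+C_6\gamma\tau_6^2/\mu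 ,$$ and every invariant probability measure $\pi$ of $Q_\gamma$ satisfies $\bigl(\int\|\theta-\theta^\star\|^6\,\pi(d\theta)\bigr)^{1/3}\le C_6\gamma\tau_6^2/\mu$. Then there exist $\Delta_1\in\mathbb R^d$ and $\Delta_2\in\mathbb R^{d\times d}$, not depending on $\gamma$, such that for every $\gamma\in(0,1/(LD_6)]$ the kernel $Q_\gamma$ has a unique invariant probability measure $\pi_\gamma$, this $\pi_\gamma$ has a finite second moment, and $$\int\theta\,\pi_\gamma(d\theta)=\theta^\star+\gamma\Delta_1+B_1\gamma^{3/2},\qquad \int(\theta-\theta^\star)^{\otimes2}\,\pi_\gamma(d\theta)=\gamma\Delta_2+B_2\gamma^{3/2},$$ where $B_1\in\mathbb R^d$ and $B_2\in\mathbb R^{d\times d}$ (which may depend on $\gamma$) satisfy $\|B_1\|\le K$ and $\|B_2\|\le K$ (Frobenius norm), with a constant $K$ that depends only on $L,\mu,\tau_6,C_6$, and in particular neither on $\gamma$ nor on $d$. Moreover, for every probability measure $\nu$ with finite second moment and every $n\ge1$, with the same $B_1$, $$\mathsf E_\nu[\bar\theta^{(\gamma)}_n]=\theta^\star+\gamma\Delta_1+B_1\gamma^{3/2}+\mathcal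 R_1,\qquad \|\mathcal R_1\|\le c\,\frac{e^{-\gamma\mu(n+1)/2}}{n\gamma\mu}\Bigl(\mathsf E_\nu^{1/2}\|\theta_0-\theta^\star\|^2+\frac{\sqrt\gamma\,\tau_2}{\sqrt\mu}\Bigr),$$ where $c$ is an absolute constant. -/

import Mathlib

open MeasureTheory ProbabilityTheory
open scoped ENNReal Gradient

noncomputable section

/-- `f` is `μ`-strongly convex on `ℝ^d`: continuously differentiable, `μ > 0`, and
`(μ/2) ‖θ - θ'‖² ≤ f θ - f θ' - ⟨∇f(θ'), θ - θ'⟩`. -/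
structure StrongConvexity {d : ℕ} (f : EuclideanSpace ℝ (Fin d) → ℝ) (μ : ℝ) : Prop where
  mu_pos : 0 < μ
  contDiff : ContDiff ℝ 1 f
  lower_bound : ∀ θ θ' : EuclideanSpace ℝ (Fin d),
    μ / 2 * ‖θ - θ'‖ ^ 2 ≤ f θ - f θ' - inner ℝ (∇ f θ') (θ - θ')

/-- `f` is four times continuously differentiable, `∇f` is `L₂`-Lipschitz, and the third and fourth
differentials are bounded by `L₃` and `L₄` (operator norm of multilinear forms). -/
structure Smoothness {d : ℕ} (f : EuclideanSpace ℝ (Fin d) → ℝ) (L₂ L₃ L₄ : ℝ) : Prop where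
  L₂_nonneg : 0 ≤ L₂
  L₃_nonneg : 0 ≤ L₃
  L₄_nonneg : 0 ≤ L₄
  contDiff : ContDiff ℝ 4 f
  lipschitz : ∀ θ θ' : EuclideanSpace ℝ (Fin d), ‖∇ f θ - ∇ f θ'‖ ≤ L₂ * ‖θ - θ'‖
  bound_three : ∀ θ, ‖iteratedFDeriv ℝ 3 f θ‖ ≤ L₃
  bound_four : ∀ θ, ‖iteratedFDeriv ℝ 4 f θ‖ ≤ L₄

/-- `𝖤^{1/p}[‖∇F(θ*, ξ)‖^p] ≤ τ` for `ξ ∼ P`. Here and below `gradF θ z` is the stochastic gradient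
`∇F(θ, z)`. -/
def OptimumNoiseBound {d : ℕ} {Z : Type*} [MeasurableSpace Z] (P : Measure Z)
    (gradF : EuclideanSpace ℝ (Fin d) → Z → EuclideanSpace ℝ (Fin d))
    (θstar : EuclideanSpace ℝ (Fin d)) (p : ℕ) (τ : ℝ) : Prop :=
  0 ≤ τ ∧ eLpNorm (gradF θstar) p P ≤ ENNReal.ofReal τ

/-- The conditions of order `p` on the stochastic gradient: it is measurable and unbiased, its
`p`-th moment at `θ*` is bounded by `τ`, and it is co-coercive in mean for every integer
`q = 2, …, p`. (That the noise variables are i.i.d. with law `P`, independently of `θ₀`, is built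
into `sgdLaw` below.) -/
structure NoiseCondition {d : ℕ} {Z : Type*} [MeasurableSpace Z] (P : Measure Z)
    (gradF : EuclideanSpace ℝ (Fin d) → Z → EuclideanSpace ℝ (Fin d))
    (f : EuclideanSpace ℝ (Fin d) → ℝ) (θstar : EuclideanSpace ℝ (Fin d))
    (p : ℕ) (L₁ τ : ℝ) : Prop where
  measurable : Measurable (Function.uncurry gradF)
  integrable : ∀ θ, Integrable (gradF θ) P
  unbiased : ∀ θ, ∫ z, gradF θ z ∂P = ∇ f θ
  moment_bound : OptimumNoiseBound P gradF θstar p τ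
  L₁_pos : 0 < L₁
  cocoercive : ∀ q : ℕ, 2 ≤ q → q ≤ p → ∀ θ₁ θ₂ : EuclideanSpace ℝ (Fin d),
    ∫⁻ z, ‖gradF θ₁ z - gradF θ₂ z‖ₑ ^ q ∂P ≤
      ENNReal.ofReal
        (L₁ ^ (q - 1) * ‖θ₁ - θ₂‖ ^ (q - 2) * inner ℝ (∇ f θ₁ - ∇ f θ₂) (θ₁ - θ₂))

/-- The Markov kernel `Q_γ(θ, A) = ∫ 1_A(θ - γ ∇F(θ, z)) P(dz)` of constant step size SGD. -/
def sgdKernel {d : ℕ} {Z : Type*} [MeasurableSpace Z] (P : Measure Z)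
    (gradF : EuclideanSpace ℝ (Fin d) → Z → EuclideanSpace ℝ (Fin d)) (γ : ℝ) :
    Kernel (EuclideanSpace ℝ (Fin d)) (EuclideanSpace ℝ (Fin d)) :=
  (Kernel.id ×ₖ Kernel.const _ P).map fun x => x.1 - γ • gradF x.1 x.2

/-- For a measurable stochastic gradient, `sgdKernel` is the kernel announced above. -/
theorem sgdKernel_apply {d : ℕ} {Z : Type*} [MeasurableSpace Z] (P : Measure Z) [SFinite P]
    (gradF : EuclideanSpace ℝ (Fin d) → Z → EuclideanSpace ℝ (Fin d)) (γ : ℝ)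
    (h : Measurable (Function.uncurry gradF)) (θ : EuclideanSpace ℝ (Fin d)) :
    sgdKernel P gradF γ θ = P.map fun z => θ - γ • gradF θ z := by
  have h1 : Measurable fun x : EuclideanSpace ℝ (Fin d) × Z => x.1 - γ • gradF x.1 x.2 :=
    measurable_fst.sub (h.const_smul γ)
  rw [sgdKernel, Kernel.map_apply _ h1, Kernel.prod_apply, Kernel.id_apply, Kernel.const_apply,
    Measure.dirac_prod, Measure.map_map h1 measurable_prodMk_left]
  rfl

/-- `π` is a stationary distribution of SGD with step size `γ`: a probability measure that is
invariant under `Q_γ`. -/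
def IsStationaryLaw {d : ℕ} {Z : Type*} [MeasurableSpace Z] (P : Measure Z)
    (gradF : EuclideanSpace ℝ (Fin d) → Z → EuclideanSpace ℝ (Fin d)) (γ : ℝ)
    (π : Measure (EuclideanSpace ℝ (Fin d))) : Prop :=
  IsProbabilityMeasure π ∧ (sgdKernel P gradF γ).Invariant π

/-- The joint law of `(θ₀, (ξ_k)_k)`: `θ₀ ∼ ν`, the `ξ_k` are i.i.d. with law `P`, and `θ₀` is
independent of `(ξ_k)_k`. Expectations `𝖤_ν` are taken under it. -/
def sgdLaw {d : ℕ} {Z : Type*} [MeasurableSpace Z] (P : Measure Z)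
    [IsProbabilityMeasure P] (ν : Measure (EuclideanSpace ℝ (Fin d))) :
    Measure (EuclideanSpace ℝ (Fin d) × (ℕ → Z)) :=
  ν.prod (Measure.infinitePi fun _ : ℕ => P)

/-- The SGD iterates `θ_{k+1} = θ_k - γ ∇F(θ_k, ξ_{k+1})` as functions of `ω = (θ₀, (ξ_k)_k)`. -/
def sgdIterate {d : ℕ} {Z : Type*}
    (gradF : EuclideanSpace ℝ (Fin d) → Z → EuclideanSpace ℝ (Fin d)) (γ : ℝ) :
    ℕ → EuclideanSpace ℝ (Fin d) × (ℕ → Z) → EuclideanSpace ℝ (Fin d)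
  | 0, ω => ω.1
  | k + 1, ω => sgdIterate gradF γ k ω - γ • gradF (sgdIterate gradF γ k ω) (ω.2 (k + 1))

/-- The Polyak-Ruppert average `(1/n) ∑_{k=n+1}^{2n} θ_k`. -/
def polyakRuppert {d : ℕ} {Z : Type*}
    (gradF : EuclideanSpace ℝ (Fin d) → Z → EuclideanSpace ℝ (Fin d)) (γ : ℝ) (n : ℕ)
    (ω : EuclideanSpace ℝ (Fin d) × (ℕ → Z)) : EuclideanSpace ℝ (Fin d) :=
  (n : ℝ)⁻¹ • ∑ k ∈ Finset.Icc (n + 1) (2 * n), sgdIterate gradF γ k ω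

/-- The moment condition of order `p` with constants `C` and `D`: for all step sizes
`0 < γ ≤ 1/(L D)`,
`𝖤_ν^{2/p}‖θ_k - θ*‖^p ≤ (1 - γμ)^k 𝖤_ν^{2/p}‖θ_0 - θ*‖^p + C γ τ² / μ` for every initial
distribution `ν` and every `k`, and `𝖤_π^{2/p}‖θ - θ*‖^p ≤ C γ τ² / μ` for the stationary `π`. -/
structure MomentCondition {d : ℕ} {Z : Type*} [MeasurableSpace Z] (P : Measure Z)
    [IsProbabilityMeasure P]
    (gradF : EuclideanSpace ℝ (Fin d) → Z → EuclideanSpace ℝ (Fin d))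
    (θstar : EuclideanSpace ℝ (Fin d)) (p : ℕ) (L μ τ C D : ℝ) : Prop where
  two_le_C : 2 ≤ C
  two_le_D : 2 ≤ D
  iterate_bound : ∀ γ : ℝ, 0 < γ → γ ≤ 1 / (L * D) →
    ∀ ν : Measure (EuclideanSpace ℝ (Fin d)), IsProbabilityMeasure ν → ∀ k : ℕ,
      eLpNorm (fun ω => sgdIterate gradF γ k ω - θstar) p (sgdLaw P ν) ^ 2 ≤
        ENNReal.ofReal ((1 - γ * μ) ^ k) * eLpNorm (fun θ => θ - θstar) p ν ^ 2 +
          ENNReal.ofReal (C * γ * τ ^ 2 / μ)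
  stationary_bound : ∀ γ : ℝ, 0 < γ → γ ≤ 1 / (L * D) →
    ∀ π : Measure (EuclideanSpace ℝ (Fin d)), IsStationaryLaw P gradF γ π →
      eLpNorm (fun θ => θ - θstar) p π ^ 2 ≤ ENNReal.ofReal (C * γ * τ ^ 2 / μ)

/-- The matrix `∫ (θ - θ*)^{⊗2} π(dθ)`, entrywise. -/
def secondMomentMatrix {d : ℕ} (θstar : EuclideanSpace ℝ (Fin d))
    (π : Measure (EuclideanSpace ℝ (Fin d))) : Matrix (Fin d) (Fin d) ℝ :=
  Matrix.of fun i j => ∫ θ, (θ i - θstar i) * (θ j - θstar j) ∂π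

/-- The Frobenius norm (an upper bound for the operator norm). -/
def frobNorm {d : ℕ} (A : Matrix (Fin d) (Fin d) ℝ) : ℝ :=
  Real.sqrt (∑ i, ∑ j, A i j ^ 2)

end

/-! Write `x = θ - θ*`, `g = ∇f`, `H` for the Hessian at `θ*`, and `s = √γ`. Applying stationarity
to linear and quadratic test functions gives two exact identities: `∫ g dπ = 0`, and, for every
operator `G`, `∫ (⟨g, G x⟩ + ⟨x, G g⟩) dπ = γ E⟨∇F, G ∇F⟩` (`integral_mean_eq_zero`,
`integral_quadratic`).

Second moments: given a test operator `A`, let `G` solve the Lyapunov equation `Hᵀ G + G H = A`.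
Replacing `g` by `H x` and the noise by its value at `θ*` turns the quadratic identity into `∫ ⟨x, A
x⟩ dπ = γ Φ(A) + O(s³ ‖A‖)`, where `Φ(A) = E⟨∇F(θ*), G ∇F(θ*)⟩` does not involve `γ`. The errors
have this order because the stationary sixth moment bound makes `∫ ‖x‖^k dπ` of order `s^k` for `k ≤
6`. The entries of `Δ₂` are the values of `Φ` at matrix units.

Mean: expanding `∫ g dπ = 0` to second order gives `H ∫ x dπ = -½ ∫ f'''[x, x] dπ + O(s³)`. The
quadratic term is known from the previous step, so `Δ₁` is defined by `⟨H Δ₁, u⟩ = -½ Φ(A u)`, where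
`A u` contracts `f'''` with `u`, and coercivity of `H` bounds the error.

Nothing depends on the dimension. The Lyapunov solution satisfies `‖G‖ ≤ ‖A‖ / (2μ)` in operator
norm (`two_mul_norm_le_norm_lyapunov`), and a functional bounded by `c` times the operator norm has
a matrix of Frobenius norm at most `c` (`frobNorm_matrixUnit_le`).

Two copies of SGD driven by the same noise contract in mean square by the factor `√(1 - γμ)` per
step. Hence a stationary law exists, as the law of a fixed point in `L²` of the noise sequence. It
is unique, and the means of the iterates converge to its mean geometrically; summing over the
averaging window yields the bound on the remainder. -/

set_option maxSynthPendingDepth 3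

/-! ### Taylor estimates and the gradient near the minimizer -/

/-- First order Taylor expansion with a second derivative bounded by `C`. -/
theorem norm_sub_fderiv_le {E W : Type*} [NormedAddCommGroup E] [NormedSpace ℝ E]
    [NormedAddCommGroup W] [NormedSpace ℝ W] {g : E → W} (hg : ContDiff ℝ 2 g) {C : ℝ}
    (hC : ∀ y, ‖iteratedFDeriv ℝ 2 g y‖ ≤ C) (a x : E) :
    ‖g (a + x) - g a - fderiv ℝ g a x‖ ≤ C * ‖x‖ ^ 2 := by
  have hd : Differentiable ℝ g := hg.differentiable (by norm_num)
  have hg' : ContDiff ℝ 1 (fderiv ℝ g) := hg.fderiv_right (by norm_num)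
  have hd' : Differentiable ℝ (fderiv ℝ g) := hg'.differentiable (by norm_num)
  have hC' : ∀ y, ‖fderiv ℝ (fderiv ℝ g) y‖ ≤ C := fun y => by
    rw [← norm_iteratedFDeriv_one, norm_iteratedFDeriv_fderiv]
    exact hC y
  have hC0 : 0 ≤ C := (norm_nonneg (fderiv ℝ (fderiv ℝ g) a)).trans (hC' a)
  have hlip : ∀ y, ‖fderiv ℝ g y - fderiv ℝ g a‖ ≤ C * ‖y - a‖ := fun y =>
    Convex.norm_image_sub_le_of_norm_fderiv_le (fun z _ => hd' z) (fun z _ => hC' z)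
      convex_univ (Set.mem_univ a) (Set.mem_univ y)
  -- Along the segment, removing the linear term leaves a curve of speed at most `C * ‖x‖ ^ 2`, so
  -- the mean value inequality suffices, at the price of the factor 1/2 of the sharp remainder.
  have hder : ∀ t : ℝ, HasDerivAt (fun t : ℝ => g (a + t • x) - t • fderiv ℝ g a x)
      (fderiv ℝ g (a + t • x) x - fderiv ℝ g a x) t := fun t => by
    have h1 : HasDerivAt (fun t : ℝ => a + t • x) x t := by
      simpa using ((hasDerivAt_id t).smul_const x).const_add a
    have h2 := (hd (a + t • x)).hasFDerivAt.comp_hasDerivAt t h1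
    have h3 := (hasDerivAt_id t).smul_const (fderiv ℝ g a x)
    rw [one_smul] at h3
    exact h2.sub h3
  have key := norm_image_sub_le_of_norm_deriv_le_segment_01'
    (f := fun t : ℝ => g (a + t • x) - t • fderiv ℝ g a x) (C := C * ‖x‖ ^ 2)
    (fun t _ => (hder t).hasDerivWithinAt) (fun t ht => by
      rw [← sub_apply]
      refine (ContinuousLinearMap.le_opNorm _ _).trans ?_
      have h3 := hlip (a + t • x)
      rw [add_sub_cancel_left, norm_smul, Real.norm_eq_abs, abs_of_nonneg ht.1] at h3
      have h4 : t * ‖x‖ ≤ ‖x‖ := mul_le_of_le_one_left (norm_nonneg _) ht.2.le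
      calc _ ≤ C * ‖x‖ * ‖x‖ := by
            refine mul_le_mul_of_nonneg_right (h3.trans ?_) (norm_nonneg _)
            exact mul_le_mul_of_nonneg_left h4 hC0
        _ = _ := by ring)
  have e : g (a + x) - g a - fderiv ℝ g a x =
      g (a + x) - fderiv ℝ g a x - g a := by abel
  rw [e]
  simpa using key

/-- Second order Taylor expansion with a third derivative bounded by `C`. -/
theorem norm_sub_fderiv_fderiv_le {E W : Type*} [NormedAddCommGroup E] [NormedSpace ℝ E]
    [NormedAddCommGroup W] [NormedSpace ℝ W] {g : E → W} (hg : ContDiff ℝ 3 g) {C : ℝ}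
    (hC : ∀ y, ‖iteratedFDeriv ℝ 3 g y‖ ≤ C) (a x : E) :
    ‖g (a + x) - g a - fderiv ℝ g a x - (1 / 2 : ℝ) • fderiv ℝ (fderiv ℝ g) a x x‖ ≤
      C * ‖x‖ ^ 3 := by
  have hd : Differentiable ℝ g := hg.differentiable (by norm_num)
  have hg' : ContDiff ℝ 2 (fderiv ℝ g) := hg.fderiv_right (by norm_num)
  have hC' : ∀ y, ‖iteratedFDeriv ℝ 2 (fderiv ℝ g) y‖ ≤ C := fun y => by
    rw [norm_iteratedFDeriv_fderiv]
    exact hC y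
  have hC0 : 0 ≤ C := (norm_nonneg _).trans (hC' a)
  set D := fderiv ℝ g a x
  set D' := fderiv ℝ (fderiv ℝ g) a x x with hD'
  have hder : ∀ t : ℝ,
      HasDerivAt (fun t : ℝ => g (a + t • x) - t • D - (t ^ 2 / 2) • D')
      (fderiv ℝ g (a + t • x) x - D - t • D') t := fun t => by
    have h1 : HasDerivAt (fun t : ℝ => a + t • x) x t := by
      simpa using ((hasDerivAt_id t).smul_const x).const_add a
    have h2 := (hd (a + t • x)).hasFDerivAt.comp_hasDerivAt t h1
    have h3 : HasDerivAt (fun t : ℝ => t ^ 2 / 2) t t := by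
      simpa using ((hasDerivAt_id t).pow 2).div_const 2
    have h4 := (hasDerivAt_id t).smul_const D
    rw [one_smul] at h4
    exact (h2.sub h4).sub (h3.smul_const D')
  have key := norm_image_sub_le_of_norm_deriv_le_segment_01'
    (f := fun t : ℝ => g (a + t • x) - t • D - (t ^ 2 / 2) • D') (C := C * ‖x‖ ^ 3)
    (fun t _ => (hder t).hasDerivWithinAt) (fun t ht => by
      -- The speed of the corrected curve is the first order Taylor remainder of `fderiv ℝ g`,
      -- evaluated at `x`.
      have h3 := norm_sub_fderiv_le hg' hC' a (t • x)
      have e : fderiv ℝ g (a + t • x) x - D - t • D' =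
          (fderiv ℝ g (a + t • x) - fderiv ℝ g a - fderiv ℝ (fderiv ℝ g) a (t • x)) x := by
        simp [D, D']
      rw [e]
      refine (ContinuousLinearMap.le_opNorm _ _).trans ?_
      rw [norm_smul, Real.norm_eq_abs, abs_of_nonneg ht.1] at h3
      have h4 : t * ‖x‖ ≤ ‖x‖ := mul_le_of_le_one_left (norm_nonneg _) ht.2.le
      have h5 : (t * ‖x‖) ^ 2 ≤ ‖x‖ ^ 2 :=
        pow_le_pow_left₀ (mul_nonneg ht.1 (norm_nonneg _)) h4 2
      calc _ ≤ C * ‖x‖ ^ 2 * ‖x‖ := by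
            refine mul_le_mul_of_nonneg_right (h3.trans ?_) (norm_nonneg _)
            exact mul_le_mul_of_nonneg_left h5 hC0
        _ = _ := by ring)
  have e : g (a + x) - g a - D - (1 / 2 : ℝ) • D' =
      g (a + x) - D - (1 / 2 : ℝ) • D' - g a := by abel
  rw [e]
  simpa using key

/-- A strongly convex function has a strongly monotone gradient. -/
theorem StrongConvexity.inner_gradient_sub {d : ℕ} {f : EuclideanSpace ℝ (Fin d) → ℝ} {μ : ℝ}
    (h : StrongConvexity f μ) (x y : EuclideanSpace ℝ (Fin d)) :
    μ * ‖x - y‖ ^ 2 ≤ inner ℝ (∇ f x - ∇ f y) (x - y) := by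
  have h1 := h.lower_bound x y
  have h2 := h.lower_bound y x
  rw [norm_sub_rev y x, ← neg_sub x y, inner_neg_right] at h2
  rw [inner_sub_left]
  linarith

/-- The gradient of a function vanishes at a minimizer. -/
theorem gradient_eq_zero_of_forall_le {E : Type*} [NormedAddCommGroup E] [InnerProductSpace ℝ E]
    [CompleteSpace E] {f : E → ℝ} {a : E} (h : ∀ x, f a ≤ f x) : ∇ f a = 0 := by
  have : fderiv ℝ f a = 0 := IsLocalMin.fderiv_eq_zero (Filter.Eventually.of_forall h)
  simp [gradient, this]

/-- The Riesz representation of real functionals, as a linear map. -/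
theorem exists_riesz (E : Type*) [NormedAddCommGroup E] [InnerProductSpace ℝ E]
    [CompleteSpace E] : ∃ R : (E →L[ℝ] ℝ) →L[ℝ] E, ∀ l u, inner ℝ (R l) u = l u :=
  ⟨LinearMap.mkContinuous
    { toFun := (InnerProductSpace.toDual ℝ E).symm
      map_add' := fun _ _ => map_add _ _ _
      map_smul' := fun _ _ => by simp } 1 fun l => by simp,
    fun _ _ => InnerProductSpace.toDual_symm_apply⟩

/-- The operators obtained from a trilinear form by fixing its last argument. -/
theorem exists_contraction {E : Type*} [NormedAddCommGroup E] [InnerProductSpace ℝ E]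
    [CompleteSpace E] {C : ℝ} (T : E →L[ℝ] E →L[ℝ] E →L[ℝ] ℝ) (hT : ‖T‖ ≤ C) :
    ∃ A : E →ₗ[ℝ] (E →L[ℝ] E), (∀ u x y, inner ℝ (A u x) y = T x y u) ∧
      ∀ u, ‖A u‖ ≤ C * ‖u‖ := by
  obtain ⟨R, hR⟩ := exists_riesz E
  have hC : 0 ≤ C := (norm_nonneg T).trans hT
  let A : E →ₗ[ℝ] (E →L[ℝ] E) :=
    { toFun := fun u => R ∘L
        ((ContinuousLinearMap.flipₗᵢ ℝ E E ℝ).toContinuousLinearEquiv.toContinuousLinearMap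
          ∘L T).flip u
      map_add' := fun u v => by ext1 x; simp
      map_smul' := fun c u => by ext1 x; simp }
  have hA : ∀ u x y, inner ℝ (A u x) y = T x y u := fun u x y => by simp [A, hR]
  refine ⟨A, hA, fun u => ?_⟩
  refine ContinuousLinearMap.opNorm_le_bound _ (mul_nonneg hC (norm_nonneg _)) fun x => ?_
  have h5 : ‖A u x‖ ^ 2 ≤ C * ‖x‖ * ‖A u x‖ * ‖u‖ := by
    rw [← real_inner_self_eq_norm_sq, hA]
    refine (le_abs_self _).trans (((T x (A u x)).le_opNorm u).trans ?_)
    refine mul_le_mul_of_nonneg_right ?_ (norm_nonneg _)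
    refine (ContinuousLinearMap.le_opNorm₂ _ _ _).trans ?_
    gcongr
  rcases (norm_nonneg (A u x)).eq_or_lt with h0 | h0
  · rw [← h0]; positivity
  · refine le_of_mul_le_mul_right ?_ h0
    nlinarith

/-- Expansion of the gradient of a smooth function at a minimizer, where the gradient is strongly
monotone: `H` is the Hessian and `A u` represents the contraction of the third derivative
with `u`. -/
theorem exists_gradient_expansion {E : Type*} [NormedAddCommGroup E] [InnerProductSpace ℝ E]
    [CompleteSpace E] {f : E → ℝ} {a : E} {μ L₃ L₄ : ℝ} (ha : ∀ x, f a ≤ f x)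
    (hc : ∀ x y, μ * ‖x - y‖ ^ 2 ≤ inner ℝ (∇ f x - ∇ f y) (x - y)) (hs : ContDiff ℝ 4 f)
    (hL₃ : ∀ x, ‖iteratedFDeriv ℝ 3 f x‖ ≤ L₃) (hL₄ : ∀ x, ‖iteratedFDeriv ℝ 4 f x‖ ≤ L₄) :
    ∃ (H : E →L[ℝ] E) (A : E →ₗ[ℝ] (E →L[ℝ] E)),
      (∀ x, μ * ‖x‖ ^ 2 ≤ inner ℝ (H x) x) ∧ (∀ u, ‖A u‖ ≤ L₃ * ‖u‖) ∧
      (∀ x, ‖∇ f (a + x) - H x‖ ≤ L₃ * ‖x‖ ^ 2) ∧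
      ∀ x u, |inner ℝ (∇ f (a + x) - H x) u - 1 / 2 * inner ℝ x (A u x)| ≤
        L₄ * ‖x‖ ^ 3 * ‖u‖ := by
  obtain ⟨R, hR⟩ := exists_riesz E
  have hg0 := gradient_eq_zero_of_forall_le ha
  have hD : ContDiff ℝ 3 (fderiv ℝ f) := hs.fderiv_right (by norm_num)
  have hD0 : fderiv ℝ f a = 0 := IsLocalMin.fderiv_eq_zero (Filter.Eventually.of_forall ha)
  have h3 : ∀ y, ‖iteratedFDeriv ℝ 2 (fderiv ℝ f) y‖ ≤ L₃ := fun y => by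
    rw [norm_iteratedFDeriv_fderiv]; exact hL₃ y
  have h4 : ∀ y, ‖iteratedFDeriv ℝ 3 (fderiv ℝ f) y‖ ≤ L₄ := fun y => by
    rw [norm_iteratedFDeriv_fderiv]; exact hL₄ y
  set D1 := fderiv ℝ (fderiv ℝ f) a with hD1
  obtain ⟨A, hA, hAn⟩ := exists_contraction (C := L₃) (fderiv ℝ (fderiv ℝ (fderiv ℝ f)) a) (by
    rw [← norm_iteratedFDeriv_one, norm_iteratedFDeriv_fderiv]
    exact h3 a)
  let H : E →L[ℝ] E := R ∘L D1
  have hH : ∀ x u, inner ℝ (H x) u = D1 x u := fun x u => by simp [H, hR]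
  have hgH : ∀ x u, inner ℝ (∇ f (a + x) - H x) u =
      (fderiv ℝ f (a + x) - fderiv ℝ f a - D1 x) u := fun x u => by
    rw [inner_sub_left, hH, inner_gradient_left, hD0]; simp
  have hlin : ∀ x, ‖∇ f (a + x) - H x‖ ≤ L₃ * ‖x‖ ^ 2 := fun x => by
    have h5 := norm_sub_fderiv_le (hD.of_le (by norm_num)) h3 a x
    refine le_trans (le_of_eq ?_) h5
    rw [← (InnerProductSpace.toDual ℝ E).symm.norm_map]
    congr 1
    refine ext_inner_right ℝ fun u => ?_
    rw [hgH, InnerProductSpace.toDual_symm_apply]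
  refine ⟨H, A, fun x => ?_, hAn, hlin, fun x u => ?_⟩
  -- Coercivity of `H` is strong monotonicity between `a + t x` and `a`, divided by `t²`, in the
  -- limit `t → 0+`.
  · have hlim : Filter.Tendsto (fun t : ℝ => inner ℝ (H x) x + L₃ * t * ‖x‖ ^ 3)
        (nhdsWithin 0 (Set.Ioi 0)) (nhds (inner ℝ (H x) x)) := by
      have : Continuous fun t : ℝ => inner ℝ (H x) x + L₃ * t * ‖x‖ ^ 3 := by fun_prop
      simpa using (this.tendsto 0).mono_left nhdsWithin_le_nhds
    refine ge_of_tendsto hlim ?_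
    filter_upwards [self_mem_nhdsWithin] with t ht
    have ht : 0 < t := ht
    have h6 := hc (a + t • x) a
    rw [hg0, sub_zero, add_sub_cancel_left, norm_smul, Real.norm_eq_abs, abs_of_pos ht] at h6
    have h7 := hlin (t • x)
    have h8 : inner ℝ (∇ f (a + t • x) - H (t • x)) (t • x) ≤ L₃ * (t * ‖x‖) ^ 2 * (t * ‖x‖) := by
      refine (real_inner_le_norm _ _).trans ?_
      rw [norm_smul, Real.norm_eq_abs, abs_of_pos ht] at h7 ⊢
      exact mul_le_mul_of_nonneg_right h7 (by positivity)
    rw [inner_sub_left, map_smul, inner_smul_left, inner_smul_right (H x)] at h8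
    simp only [conj_trivial] at h8
    have h9 : t ^ 2 * (μ * ‖x‖ ^ 2) ≤ t ^ 2 * (inner ℝ (H x) x + L₃ * t * ‖x‖ ^ 3) := by
      nlinarith
    exact le_of_mul_le_mul_left h9 (by positivity)
  · have h5 := norm_sub_fderiv_fderiv_le hD h4 a x
    rw [real_inner_comm (A u x), hA, hgH]
    have e : (fderiv ℝ f (a + x) - fderiv ℝ f a - D1 x) u -
        1 / 2 * fderiv ℝ (fderiv ℝ (fderiv ℝ f)) a x x u =
      (fderiv ℝ f (a + x) - fderiv ℝ f a - D1 x -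
        (1 / 2 : ℝ) • fderiv ℝ (fderiv ℝ (fderiv ℝ f)) a x x) u := by simp
    rw [e]
    exact (ContinuousLinearMap.le_opNorm _ _).trans
      (mul_le_mul_of_nonneg_right h5 (norm_nonneg _))

/-! ### The Lyapunov equation in operator norm -/

/-- A coercive operator satisfies `2 μ ‖G‖ ≤ ‖Hᵀ G + G H‖` for every `G`. -/
theorem two_mul_norm_le_norm_lyapunov {E : Type*} [NormedAddCommGroup E] [InnerProductSpace ℝ E]
    [FiniteDimensional ℝ E] {H : E →L[ℝ] E} {μ : ℝ}
    (hH : ∀ x, μ * ‖x‖ ^ 2 ≤ inner ℝ (H x) x) (G : E →L[ℝ] E) :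
    2 * μ * ‖G‖ ≤ ‖H.adjoint ∘L G + G ∘L H‖ := by
  rcases (norm_nonneg G).eq_or_lt with h0 | h0
  · rw [← h0, mul_zero]; exact norm_nonneg _
  have hE : Nontrivial E := by
    by_contra h
    rw [not_nontrivial_iff_subsingleton] at h
    exact h0.ne' (by rw [Subsingleton.elim G 0, norm_zero])
  obtain ⟨v, hv, hmax⟩ := (isCompact_sphere (0 : E) 1).exists_isMaxOn
    (NormedSpace.sphere_nonempty.2 zero_le_one) (f := fun v => ‖G v‖) (by fun_prop)
  have hv1 : ‖v‖ = 1 := by simpa using hv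
  have hGv : ‖G v‖ = ‖G‖ := by
    refine le_antisymm (by simpa [hv1] using G.le_opNorm v) ?_
    refine G.opNorm_le_of_unit_norm (norm_nonneg _) fun x hx => hmax (by simpa using hx)
  -- `v` is a right singular vector for the largest singular value
  have hadj : G.adjoint (G v) = (‖G‖ ^ 2) • v := by
    have h1 : inner ℝ (G.adjoint (G v)) v = ‖G‖ ^ 2 := by
      rw [ContinuousLinearMap.adjoint_inner_left, real_inner_self_eq_norm_sq, hGv]
    have h2 : ‖G.adjoint (G v)‖ ≤ ‖G‖ ^ 2 := by
      refine (ContinuousLinearMap.le_opNorm _ _).trans (le_of_eq ?_)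
      rw [hGv, LinearIsometryEquiv.norm_map]; ring
    -- Equality case of Cauchy-Schwarz: the square expands to at most `‖G‖⁴ - 2‖G‖⁴ + ‖G‖⁴`.
    have h3 : ‖G.adjoint (G v) - (‖G‖ ^ 2) • v‖ ^ 2 ≤ 0 := by
      rw [norm_sub_sq_real, inner_smul_right, h1, norm_smul, hv1, Real.norm_eq_abs,
        abs_of_nonneg (sq_nonneg _)]
      nlinarith [pow_le_pow_left₀ (norm_nonneg _) h2 2]
    exact sub_eq_zero.1 (norm_eq_zero.1 (pow_eq_zero_iff two_ne_zero |>.1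
      (le_antisymm h3 (sq_nonneg _))))
  -- Since `Gᵀ G v = ‖G‖² v`, pairing with `G v` turns both terms into quadratic forms of `H`, at `G
  -- v` and at `v`, each at least `μ ‖G‖²`.
  have h4 : inner ℝ (G v) ((H.adjoint ∘L G + G ∘L H) v) =
      inner ℝ (H (G v)) (G v) + ‖G‖ ^ 2 * inner ℝ (H v) v := by
    simp only [add_apply, ContinuousLinearMap.comp_apply, inner_add_right]
    rw [ContinuousLinearMap.adjoint_inner_right, ← ContinuousLinearMap.adjoint_inner_left G (H v), hadj,
      inner_smul_left, real_inner_comm v]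
    simp
  have h5 : inner ℝ (G v) ((H.adjoint ∘L G + G ∘L H) v) ≤
      ‖G‖ * ‖H.adjoint ∘L G + G ∘L H‖ := by
    refine (real_inner_le_norm _ _).trans ?_
    rw [hGv]
    gcongr
    simpa [hv1] using ContinuousLinearMap.le_opNorm (H.adjoint ∘L G + G ∘L H) v
  have h6 := hH (G v)
  have h7 := hH v
  rw [hGv] at h6
  rw [hv1] at h7
  refine le_of_mul_le_mul_left ?_ h0
  nlinarith [mul_le_mul_of_nonneg_left h7 (sq_nonneg ‖G‖)]

/-- The Lyapunov equation `Hᵀ G + G H = A` of a coercive operator, solved linearly in `A`. -/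
theorem exists_lyapunov {E : Type*} [NormedAddCommGroup E] [InnerProductSpace ℝ E]
    [FiniteDimensional ℝ E] {H : E →L[ℝ] E} {μ : ℝ} (hμ : 0 < μ)
    (hH : ∀ x, μ * ‖x‖ ^ 2 ≤ inner ℝ (H x) x) :
    ∃ G : (E →L[ℝ] E) →ₗ[ℝ] (E →L[ℝ] E), ∀ A : E →L[ℝ] E,
      (∀ x, inner ℝ (H x) (G A x) + inner ℝ x (G A (H x)) = inner ℝ x (A x)) ∧
      2 * μ * ‖G A‖ ≤ ‖A‖ := by
  let S : (E →L[ℝ] E) →ₗ[ℝ] (E →L[ℝ] E) :=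
    { toFun := fun G => H.adjoint ∘L G + G ∘L H
      map_add' := fun G G' => by simp only [ContinuousLinearMap.comp_add,
        ContinuousLinearMap.add_comp]; abel
      map_smul' := fun c G => by ext x; simp [smul_add] }
  have hS : ∀ G, 2 * μ * ‖G‖ ≤ ‖S G‖ := two_mul_norm_le_norm_lyapunov hH
  have hinj : Function.Injective S := by
    refine (injective_iff_map_eq_zero S).2 fun G hG => ?_
    have h1 := hS G
    rw [hG, norm_zero] at h1
    have h2 : ‖G‖ ≤ 0 := nonpos_of_mul_nonpos_right h1 (by positivity)
    exact norm_le_zero_iff.1 h2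
  have hfin : FiniteDimensional ℝ (E →L[ℝ] E) := inferInstance
  let e := LinearEquiv.ofInjectiveEndo S hinj
  have he : ∀ A, S (e.symm A) = A := fun A => e.apply_symm_apply A
  refine ⟨e.symm, fun A => ⟨fun x => ?_, ?_⟩⟩
  · conv_rhs => rw [← he A]
    change _ = inner ℝ x ((H.adjoint ∘L e.symm A + e.symm A ∘L H) x)
    simp only [add_apply, ContinuousLinearMap.comp_apply, inner_add_right,
      ContinuousLinearMap.adjoint_inner_right]
    rfl
  · have h1 := hS (e.symm A)
    rwa [he] at h1

/-! ### Mean-square contraction of one SGD step -/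

theorem eLpNorm_natCast_pow_eq_lintegral {Ω V : Type*} [MeasurableSpace Ω] [NormedAddCommGroup V]
    (m : Measure Ω) (X : Ω → V) {n : ℕ} (hn : n ≠ 0) :
    eLpNorm X n m ^ n = ∫⁻ ω, ‖X ω‖ₑ ^ n ∂m := by
  have h := eLpNorm_nnreal_pow_eq_lintegral (μ := m) (f := X) (p := (n : NNReal))
    (by exact_mod_cast hn)
  simpa [ENNReal.rpow_natCast] using h

theorem eLpNorm_two_sq_eq_lintegral {Ω V : Type*} [MeasurableSpace Ω] [NormedAddCommGroup V]
    (m : Measure Ω) (X : Ω → V) : eLpNorm X 2 m ^ 2 = ∫⁻ ω, ‖X ω‖ₑ ^ 2 ∂m := by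
  simpa using eLpNorm_natCast_pow_eq_lintegral m X two_ne_zero

theorem MeasureTheory.MemLp.eLpNorm_two_eq_sqrt {Ω V : Type*} [MeasurableSpace Ω]
    [NormedAddCommGroup V] {m : Measure Ω} {X : Ω → V} (hX : MemLp X 2 m) :
    eLpNorm X 2 m = ENNReal.ofReal √(∫ ω, ‖X ω‖ ^ 2 ∂m) := by
  rw [hX.eLpNorm_eq_integral_rpow_norm two_ne_zero ENNReal.ofNat_ne_top, Real.sqrt_eq_rpow]
  norm_num

section SGD

variable {d : ℕ} {Z : Type*} [MeasurableSpace Z]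

/-- The properties of a stochastic gradient `gradF` with mean `g` that make SGD a contraction in
mean square. -/
structure CocoerciveNoise (P : Measure Z)
    (gradF : EuclideanSpace ℝ (Fin d) → Z → EuclideanSpace ℝ (Fin d))
    (g : EuclideanSpace ℝ (Fin d) → EuclideanSpace ℝ (Fin d)) (a : EuclideanSpace ℝ (Fin d))
    (μ L : ℝ) : Prop where
  measurable : Measurable (Function.uncurry gradF)
  integrable : ∀ x, Integrable (gradF x) P
  unbiased : ∀ x, ∫ z, gradF x z ∂P = g x
  memLp : MemLp (gradF a) 2 P
  zero : g a = 0
  mu_pos : 0 < μ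
  L_pos : 0 < L
  lipschitz : ∀ x y, ‖g x - g y‖ ≤ L * ‖x - y‖
  strongly_monotone : ∀ x y, μ * ‖x - y‖ ^ 2 ≤ inner ℝ (g x - g y) (x - y)
  cocoercive : ∀ x y, ∫⁻ z, ‖gradF x z - gradF y z‖ₑ ^ 2 ∂P ≤
    ENNReal.ofReal (L * inner ℝ (g x - g y) (x - y))

/-- One step of SGD. -/
def sgdStep (gradF : EuclideanSpace ℝ (Fin d) → Z → EuclideanSpace ℝ (Fin d)) (γ : ℝ)
    (x : EuclideanSpace ℝ (Fin d) × Z) : EuclideanSpace ℝ (Fin d) :=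
  x.1 - γ • gradF x.1 x.2

variable {P : Measure Z} {gradF : EuclideanSpace ℝ (Fin d) → Z → EuclideanSpace ℝ (Fin d)}
  {g : EuclideanSpace ℝ (Fin d) → EuclideanSpace ℝ (Fin d)} {a : EuclideanSpace ℝ (Fin d)}
  {μ L γ : ℝ}

theorem measurable_sgdStep (h : Measurable (Function.uncurry gradF)) (γ : ℝ) :
    Measurable (sgdStep gradF γ) :=
  measurable_fst.sub (h.const_smul γ)

/-- Integrals against `π` can then be rewritten over the product of iterate and fresh noise. -/
theorem isStationaryLaw_iff [IsProbabilityMeasure P] (h : Measurable (Function.uncurry gradF))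
    (γ : ℝ) {π : Measure (EuclideanSpace ℝ (Fin d))} :
    IsStationaryLaw P gradF γ π ↔
      IsProbabilityMeasure π ∧ (π.prod P).map (sgdStep gradF γ) = π := by
  refine and_congr_right fun hπ => ?_
  have : π.bind (sgdKernel P gradF γ) = (π.prod P).map (sgdStep gradF γ) := by
    rw [← Measure.compProd_const, Measure.compProd_eq_comp_prod,
      Measure.map_comp _ _ (measurable_sgdStep h γ)]
    rfl
  rw [Kernel.Invariant, this]

namespace CocoerciveNoise

theorem continuous_mean (h : CocoerciveNoise P gradF g a μ L) : Continuous g :=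
  (LipschitzWith.of_dist_le_mul (K := L.toNNReal) fun x y => by
    rw [dist_eq_norm, dist_eq_norm, Real.coe_toNNReal _ h.L_pos.le]
    exact h.lipschitz x y).continuous

theorem norm_mean_le (h : CocoerciveNoise P gradF g a μ L) (x : EuclideanSpace ℝ (Fin d)) :
    ‖g x‖ ≤ L * ‖x - a‖ := by
  simpa [h.zero] using h.lipschitz x a

theorem memLp_mean {π : Measure (EuclideanSpace ℝ (Fin d))} [IsProbabilityMeasure π]
    (h : CocoerciveNoise P gradF g a μ L) (hm : MemLp (fun x => x) 2 π) :
    MemLp g 2 π :=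
  (hm.sub (memLp_const a)).of_le_mul h.continuous_mean.aestronglyMeasurable
    (Filter.Eventually.of_forall h.norm_mean_le)

theorem memLp_sub (h : CocoerciveNoise P gradF g a μ L) (x y : EuclideanSpace ℝ (Fin d)) :
    MemLp (fun z => gradF x z - gradF y z) 2 P := by
  refine ⟨((h.integrable x).sub (h.integrable y)).aestronglyMeasurable, ?_⟩
  have h1 := (eLpNorm_two_sq_eq_lintegral P fun z => gradF x z - gradF y z).trans_le
    (h.cocoercive x y)
  by_contra h2
  rw [not_lt_top_iff.1 h2] at h1
  simp at h1

theorem integral_norm_sub_sq_le (h : CocoerciveNoise P gradF g a μ L)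
    (x y : EuclideanSpace ℝ (Fin d)) :
    ∫ z, ‖gradF x z - gradF y z‖ ^ 2 ∂P ≤ L * inner ℝ (g x - g y) (x - y) := by
  have h0 : 0 ≤ L * inner ℝ (g x - g y) (x - y) := mul_nonneg h.L_pos.le
    ((mul_nonneg h.mu_pos.le (sq_nonneg _)).trans (h.strongly_monotone x y))
  rw [← ENNReal.ofReal_le_ofReal_iff h0,
    ofReal_integral_eq_lintegral_ofReal ((h.memLp_sub x y).integrable_norm_pow two_ne_zero)
      (Filter.Eventually.of_forall fun z => by positivity)]
  refine le_trans (le_of_eq ?_) (h.cocoercive x y)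
  refine lintegral_congr fun z => ?_
  rw [ENNReal.ofReal_pow (norm_nonneg _), ofReal_norm]

variable [IsProbabilityMeasure P]

/-- Mean square contraction of one step from two deterministic points. -/
theorem lintegral_sgdStep_sub_le (h : CocoerciveNoise P gradF g a μ L) (hγ : 0 < γ)
    (hγL : γ * L ≤ 1 / 2) (x y : EuclideanSpace ℝ (Fin d)) :
    ∫⁻ z, ‖sgdStep gradF γ (x, z) - sgdStep gradF γ (y, z)‖ₑ ^ 2 ∂P ≤
      ENNReal.ofReal √(1 - γ * μ) ^ 2 * ‖x - y‖ₑ ^ 2 := by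
  set D := fun z => gradF x z - gradF y z with hD
  have hDi : Integrable D P := (h.integrable x).sub (h.integrable y)
  have hD2 : Integrable (fun z => ‖D z‖ ^ 2) P := ((h.memLp_sub x y).integrable_norm_pow two_ne_zero)
  have hDg : ∫ z, D z ∂P = g x - g y := by
    rw [hD, integral_sub (h.integrable x) (h.integrable y), h.unbiased, h.unbiased]
  have e : ∀ z, ‖sgdStep gradF γ (x, z) - sgdStep gradF γ (y, z)‖ ^ 2 =
      ‖x - y‖ ^ 2 - 2 * γ * inner ℝ (x - y) (D z) + γ ^ 2 * ‖D z‖ ^ 2 := fun z => by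
    have : sgdStep gradF γ (x, z) - sgdStep gradF γ (y, z) = (x - y) - γ • D z := by
      simp only [sgdStep, hD, smul_sub]; abel
    rw [this, norm_sub_sq_real, inner_smul_right, norm_smul, Real.norm_eq_abs, mul_pow, sq_abs]
    ring
  have hi1 : Integrable (fun z => inner ℝ (x - y) (D z)) P := hDi.const_inner _
  have hi2 : Integrable (fun z => ‖x - y‖ ^ 2 - 2 * γ * inner ℝ (x - y) (D z)) P :=
    (integrable_const _).sub (hi1.const_mul _)
  have hint : Integrable (fun z => ‖sgdStep gradF γ (x, z) - sgdStep gradF γ (y, z)‖ ^ 2) P := by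
    simp_rw [e]
    exact hi2.add (hD2.const_mul _)
  have hval : ∫ z, ‖sgdStep gradF γ (x, z) - sgdStep gradF γ (y, z)‖ ^ 2 ∂P =
      ‖x - y‖ ^ 2 - 2 * γ * inner ℝ (g x - g y) (x - y) + γ ^ 2 * ∫ z, ‖D z‖ ^ 2 ∂P := by
    simp_rw [e]
    rw [integral_add hi2 (hD2.const_mul _),
      integral_sub (integrable_const _) (hi1.const_mul _), integral_const_mul, integral_const_mul,
      integral_inner hDi, hDg, real_inner_comm]
    simp
  have h1 := h.integral_norm_sub_sq_le x y
  have h2 := h.strongly_monotone x y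
  have h3 : 0 ≤ inner ℝ (g x - g y) (x - y) := (mul_nonneg h.mu_pos.le (sq_nonneg _)).trans h2
  have h4 : ∫ z, ‖sgdStep gradF γ (x, z) - sgdStep gradF γ (y, z)‖ ^ 2 ∂P ≤
      (1 - γ * μ) * ‖x - y‖ ^ 2 := by
    -- Co-coercivity and `γ * L ≤ 1 / 2` absorb the second order term into a quarter of the cross
    -- term; what remains of the latter gives the factor `1 - γ * μ`.
    have h5 : γ ^ 2 * ∫ z, ‖D z‖ ^ 2 ∂P ≤ γ * (1 / 2 * inner ℝ (g x - g y) (x - y)) := by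
      calc _ ≤ γ ^ 2 * (L * inner ℝ (g x - g y) (x - y)) := by gcongr
        _ = γ * ((γ * L) * inner ℝ (g x - g y) (x - y)) := by ring
        _ ≤ _ := by gcongr
    rw [hval]
    nlinarith [mul_le_mul_of_nonneg_left h2 hγ.le, mul_nonneg hγ.le h3]
  -- The square root of a negative number is 0 by convention, so the bound needs no sign condition
  -- on `1 - γ * μ`.
  have h5 : (1 - γ * μ) * ‖x - y‖ ^ 2 ≤ √(1 - γ * μ) ^ 2 * ‖x - y‖ ^ 2 := by
    refine mul_le_mul_of_nonneg_right ?_ (sq_nonneg _)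
    rcases le_total 0 (1 - γ * μ) with h6 | h6
    · rw [Real.sq_sqrt h6]
    · exact h6.trans (sq_nonneg _)
  calc _ = ENNReal.ofReal (∫ z, ‖sgdStep gradF γ (x, z) - sgdStep gradF γ (y, z)‖ ^ 2 ∂P) := by
        rw [ofReal_integral_eq_lintegral_ofReal hint
          (Filter.Eventually.of_forall fun z => by positivity)]
        refine lintegral_congr fun z => ?_
        rw [ENNReal.ofReal_pow (norm_nonneg _), ofReal_norm]
    _ ≤ ENNReal.ofReal (√(1 - γ * μ) ^ 2 * ‖x - y‖ ^ 2) :=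
        ENNReal.ofReal_le_ofReal (h4.trans h5)
    _ = _ := by
        rw [ENNReal.ofReal_mul (by positivity), ENNReal.ofReal_pow (Real.sqrt_nonneg _),
          ENNReal.ofReal_pow (norm_nonneg _), ofReal_norm]

/-- Mean square contraction of one step from two random points, independent of the noise. -/
theorem eLpNorm_sgdStep_sub_le (h : CocoerciveNoise P gradF g a μ L) (hγ : 0 < γ)
    (hγL : γ * L ≤ 1 / 2) {Ω : Type*} [MeasurableSpace Ω] (m : Measure Ω) [SFinite m]
    {X Y : Ω → EuclideanSpace ℝ (Fin d)} (hX : Measurable X) (hY : Measurable Y) :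
    eLpNorm (fun p : Ω × Z => sgdStep gradF γ (X p.1, p.2) - sgdStep gradF γ (Y p.1, p.2)) 2
      (m.prod P) ≤ ENNReal.ofReal √(1 - γ * μ) * eLpNorm (fun ω => X ω - Y ω) 2 m := by
  have hm := measurable_sgdStep h.measurable γ
  refine (ENNReal.pow_le_pow_left_iff two_ne_zero).1 ?_
  rw [mul_pow, eLpNorm_two_sq_eq_lintegral, eLpNorm_two_sq_eq_lintegral, lintegral_prod _ (by
    refine Measurable.aemeasurable (Measurable.pow_const (Measurable.enorm ?_) _)
    exact (hm.comp (by fun_prop)).sub (hm.comp (by fun_prop))),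
    ← lintegral_const_mul _ (by fun_prop)]
  exact lintegral_mono fun ω => h.lintegral_sgdStep_sub_le hγ hγL (X ω) (Y ω)

theorem memLp_sgdStep (h : CocoerciveNoise P gradF g a μ L) (hγ : 0 < γ)
    (hγL : γ * L ≤ 1 / 2) {Ω : Type*} [MeasurableSpace Ω] (m : Measure Ω) [IsProbabilityMeasure m]
    {X : Ω → EuclideanSpace ℝ (Fin d)} (hX : Measurable X) (hX2 : MemLp X 2 m) :
    MemLp (fun p : Ω × Z => sgdStep gradF γ (X p.1, p.2)) 2 (m.prod P) := by
  have hm := measurable_sgdStep h.measurable γ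
  have h1 : MemLp (fun p : Ω × Z => sgdStep gradF γ (X p.1, p.2) - sgdStep gradF γ (a, p.2)) 2
      (m.prod P) := by
    refine ⟨Measurable.aestronglyMeasurable
      ((hm.comp (by fun_prop)).sub (hm.comp (by fun_prop))), ?_⟩
    refine (h.eLpNorm_sgdStep_sub_le hγ hγL m hX measurable_const).trans_lt ?_
    exact ENNReal.mul_lt_top ENNReal.ofReal_lt_top (hX2.sub (memLp_const a)).eLpNorm_lt_top
  have h2 : MemLp (fun p : Ω × Z => sgdStep gradF γ (a, p.2)) 2 (m.prod P) :=
    (memLp_const a).sub ((h.memLp.comp_measurePreserving measurePreserving_snd).const_smul γ)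
  have h3 := h1.add h2
  convert h3 using 1
  ext1 p
  simp

/-- The gradient is a multiple of the displacement in a step of size `1 / (2 * L)`, and that step
preserves square integrability. -/
theorem memLp_gradF (h : CocoerciveNoise P gradF g a μ L) {Ω : Type*} [MeasurableSpace Ω]
    (m : Measure Ω) [IsProbabilityMeasure m] {X : Ω → EuclideanSpace ℝ (Fin d)} (hX : Measurable X)
    (hX2 : MemLp X 2 m) : MemLp (fun p : Ω × Z => gradF (X p.1) p.2) 2 (m.prod P) := by
  have hL := h.L_pos
  have hγ : 0 < 1 / (2 * L) := by positivity
  have h1 := ((hX2.comp_measurePreserving measurePreserving_fst).sub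
    (h.memLp_sgdStep hγ (by field_simp; norm_num) m hX hX2)).const_smul (2 * L)
  refine (congrArg (MemLp · 2 (m.prod P)) (funext fun p => ?_)).mp h1
  have e : 2 * L * (L⁻¹ * 2⁻¹) = 1 := by field_simp
  simp [sgdStep, smul_smul, e]

end CocoerciveNoise

end SGD

/-! ### The noise sequence and the laws of the iterates -/

/-- The first coordinate and the remaining ones of an i.i.d. sequence are independent. -/
theorem measurePreserving_infinitePi_cons {Z : Type*} [MeasurableSpace Z] (P : Measure Z)
    [IsProbabilityMeasure P] :
    MeasurePreserving (fun ω : ℕ → Z => ((fun n => ω (n + 1) : ℕ → Z), ω 0))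
      (Measure.infinitePi fun _ => P) ((Measure.infinitePi fun _ : ℕ => P).prod P) := by
  -- The inverse map, which prepends a coordinate, is easier to handle: it pulls boxes back to
  -- products of boxes, and boxes determine the infinite product measure.
  let c : (ℕ → Z) × Z → (ℕ → Z) := fun p n => n.casesOn p.2 p.1
  have hc : Measurable c := measurable_pi_lambda _ fun n => by
    cases n with
    | zero => exact measurable_snd
    | succ n => exact (measurable_pi_apply n).comp measurable_fst
  have key : ((Measure.infinitePi fun _ : ℕ => P).prod P).map c =
      Measure.infinitePi fun _ => P := by
    refine Measure.eq_infinitePi _ fun s t ht => ?_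
    have e : c ⁻¹' Set.pi s t = Set.pi ((s.erase 0).preimage Nat.succ
        Nat.succ_injective.injOn : Finset ℕ) (fun n => t (n + 1)) ×ˢ
        (if 0 ∈ s then t 0 else Set.univ) := by
      ext p
      simp only [Set.mem_preimage, Set.mem_pi, Set.mem_prod, Finset.mem_coe, Finset.mem_preimage,
        Finset.mem_erase]
      constructor
      · refine fun h => ⟨fun n hn => h _ hn.2, ?_⟩
        split_ifs with h0
        · exact h 0 h0
        · trivial
      · rintro ⟨h1, h2⟩ (_ | n) hn
        · rwa [if_pos hn] at h2
        · exact h1 n ⟨n.succ_ne_zero, hn⟩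
    rw [Measure.map_apply hc (MeasurableSet.pi s.countable_toSet fun i _ => ht i), e,
      Measure.prod_prod, Measure.infinitePi_pi _ fun i _ => ht _,
      Finset.prod_preimage Nat.succ _ _ fun n => P (t n)]
    · split_ifs with h0
      · rw [Finset.prod_erase_mul _ _ h0]
      · rw [Finset.erase_eq_of_notMem h0, measure_univ, mul_one]
    · rintro (_ | n) hn hn'
      · simp at hn
      · exact absurd ⟨n, rfl⟩ hn'
  have hs : Measurable (fun ω : ℕ → Z => ((fun n => ω (n + 1) : ℕ → Z), ω 0)) := by fun_prop
  refine ⟨hs, ?_⟩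
  conv_lhs => rw [← key]
  rw [Measure.map_map hs hc]
  exact Measure.map_id

/-- Replacing one coordinate of an i.i.d. sequence by a fresh independent variable does not change
its law. -/
theorem measurePreserving_infinitePi_update {Z : Type*} [MeasurableSpace Z] (P : Measure Z)
    [IsProbabilityMeasure P] (k : ℕ) :
    MeasurePreserving (fun p : (ℕ → Z) × Z => Function.update p.1 k p.2)
      ((Measure.infinitePi fun _ : ℕ => P).prod P) (Measure.infinitePi fun _ => P) := by
  have hc : Measurable (fun p : (ℕ → Z) × Z => Function.update p.1 k p.2) := by
    fun_prop
  refine ⟨hc, ?_⟩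
  refine Measure.eq_infinitePi _ fun s t ht => ?_
  have e : (fun p : (ℕ → Z) × Z => Function.update p.1 k p.2) ⁻¹' Set.pi s t =
      Set.pi (s.erase k : Finset ℕ) t ×ˢ (if k ∈ s then t k else Set.univ) := by
    ext p
    simp only [Set.mem_preimage, Set.mem_pi, Set.mem_prod, Finset.mem_coe, Finset.mem_erase]
    constructor
    · refine fun h => ⟨fun n hn => by simpa [hn.1] using h n hn.2, ?_⟩
      split_ifs with h0
      · simpa using h k h0
      · trivial
    · rintro ⟨h1, h2⟩ n hn
      rcases eq_or_ne n k with rfl | hk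
      · simpa [hn] using h2
      · simpa [hk] using h1 n ⟨hk, hn⟩
  rw [Measure.map_apply hc (MeasurableSet.pi s.countable_toSet fun i _ => ht i), e,
    Measure.prod_prod, Measure.infinitePi_pi _ fun i _ => ht _]
  split_ifs with h0
  · rw [Finset.prod_erase_mul _ _ h0]
  · rw [Finset.erase_eq_of_notMem h0, measure_univ, mul_one]

/-- The `j`-th iterate reads only the noises of index `1, …, j`. -/
theorem sgdIterate_update {d : ℕ} {Z : Type*}
    (gradF : EuclideanSpace ℝ (Fin d) → Z → EuclideanSpace ℝ (Fin d))
    (γ : ℝ) (x : EuclideanSpace ℝ (Fin d)) (ω : ℕ → Z) (z : Z) {j k : ℕ} (hjk : j < k) :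
    sgdIterate gradF γ j (x, Function.update ω k z) = sgdIterate gradF γ j (x, ω) := by
  induction j with
  | zero => rfl
  | succ j ih => simp [sgdIterate, ih (by omega), hjk.ne]

section Stationary

variable {d : ℕ} {Z : Type*} [MeasurableSpace Z] {P : Measure Z} [IsProbabilityMeasure P]
  {gradF : EuclideanSpace ℝ (Fin d) → Z → EuclideanSpace ℝ (Fin d)}
  {g : EuclideanSpace ℝ (Fin d) → EuclideanSpace ℝ (Fin d)} {a : EuclideanSpace ℝ (Fin d)}
  {μ L γ : ℝ}

theorem measurable_sgdIterate (h : Measurable (Function.uncurry gradF)) (γ : ℝ) (k : ℕ) :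
    Measurable (sgdIterate gradF γ k) := by
  induction k with
  | zero => exact measurable_fst
  | succ k ih =>
    exact (measurable_sgdStep h γ).comp
      (ih.prodMk ((measurable_pi_apply (k + 1)).comp measurable_snd))

instance (ν : Measure (EuclideanSpace ℝ (Fin d))) [IsProbabilityMeasure ν] :
    IsProbabilityMeasure (sgdLaw P ν) := by
  unfold sgdLaw; infer_instance

/-- The law of the next iterate is obtained by one SGD step with an independent noise. -/
theorem sgdLaw_map_sgdIterate_succ (h : Measurable (Function.uncurry gradF)) (γ : ℝ)
    (ν : Measure (EuclideanSpace ℝ (Fin d))) [IsProbabilityMeasure ν] (k : ℕ) :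
    (sgdLaw P ν).map (sgdIterate gradF γ (k + 1)) =
      (((sgdLaw P ν).map (sgdIterate gradF γ k)).prod P).map (sgdStep gradF γ) := by
  have hk := measurable_sgdIterate h γ k
  -- Resampling coordinate `k + 1` keeps the joint law and does not touch the `k`-th iterate, which
  -- exhibits the new noise as independent of it.
  have hU := ((MeasurePreserving.id ν).prod
    (measurePreserving_infinitePi_update P (k + 1))).comp
      (measurePreserving_prodAssoc ν (Measure.infinitePi fun _ : ℕ => P) P)
  conv_lhs => rw [sgdLaw, ← hU.map_eq]
  rw [Measure.map_map (measurable_sgdIterate h γ (k + 1)) hU.measurable]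
  have h2 : ((sgdLaw P ν).map (sgdIterate gradF γ k)).prod P =
      ((sgdLaw P ν).prod P).map (Prod.map (sgdIterate gradF γ k) id) := by
    rw [← Measure.map_prod_map _ _ hk measurable_id, Measure.map_id]
  rw [h2, Measure.map_map (measurable_sgdStep h γ) (hk.prodMap measurable_id)]
  refine congrArg (fun F => Measure.map F _) (funext fun p => ?_)
  obtain ⟨⟨x, ω⟩, z⟩ := p
  simp [sgdIterate, sgdStep, MeasurableEquiv.prodAssoc, sgdIterate_update]

theorem sgdLaw_map_sgdIterate_zero (ν : Measure (EuclideanSpace ℝ (Fin d))) :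
    (sgdLaw P ν).map (sgdIterate gradF γ 0) = ν := by
  have : sgdIterate gradF γ 0 = Prod.fst := rfl
  rw [this, sgdLaw, Measure.map_fst_prod, measure_univ, one_smul]

theorem IsStationaryLaw.sgdLaw_map_sgdIterate (h : Measurable (Function.uncurry gradF))
    {π : Measure (EuclideanSpace ℝ (Fin d))} (hπ : IsStationaryLaw P gradF γ π) (k : ℕ) :
    (sgdLaw P π).map (sgdIterate gradF γ k) = π := by
  have := hπ.1
  induction k with
  | zero => exact sgdLaw_map_sgdIterate_zero π
  | succ k ih => rw [sgdLaw_map_sgdIterate_succ h, ih, ((isStationaryLaw_iff h γ).1 hπ).2]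

theorem sqrt_one_sub_lt_one {x : ℝ} (hx : 0 < x) : √(1 - x) < 1 := by
  rw [Real.sqrt_lt' one_pos]; linarith

/-! ### Existence, uniqueness and attraction of the stationary law -/

namespace CocoerciveNoise

/-- The law of a fixed point of the random iteration is stationary. -/
theorem exists_isStationaryLaw (h : CocoerciveNoise P gradF g a μ L) (hγ : 0 < γ)
    (hγL : γ * L ≤ 1 / 2) : ∃ π, IsStationaryLaw P gradF γ π := by
  let m : Measure (ℕ → Z) := Measure.infinitePi fun _ => P
  have hS := measurePreserving_infinitePi_cons P
  have hstep := measurable_sgdStep h.measurable γ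
  have hmem : ∀ X : Lp (EuclideanSpace ℝ (Fin d)) 2 m,
      MemLp (fun ω : ℕ → Z => sgdStep gradF γ (X (fun n => ω (n + 1)), ω 0)) 2 m := fun X =>
    (h.memLp_sgdStep hγ hγL m (Lp.stronglyMeasurable X).measurable
      (Lp.memLp X)).comp_measurePreserving hS
  -- Iteration from the infinite past: `ω 0` is the latest noise and the shifted sequence carries
  -- the earlier ones. A fixed point has the same law before and after the step, because the shift
  -- preserves the law and is independent of `ω 0`.
  let T : Lp (EuclideanSpace ℝ (Fin d)) 2 m → Lp (EuclideanSpace ℝ (Fin d)) 2 m :=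
    fun X => (hmem X).toLp _
  have hT : ContractingWith (√(1 - γ * μ)).toNNReal T := by
    refine ⟨?_, fun X Y => ?_⟩
    · rw [Real.toNNReal_lt_one]
      exact sqrt_one_sub_lt_one (mul_pos hγ h.mu_pos)
    · have hX := (Lp.stronglyMeasurable X).measurable
      have hY := (Lp.stronglyMeasurable Y).measurable
      rw [Lp.edist_toLp_toLp, Lp.edist_def]
      have h1 := h.eLpNorm_sgdStep_sub_le hγ hγL m hX hY
      have h2 : Measurable fun p : (ℕ → Z) × Z =>
          sgdStep gradF γ (X p.1, p.2) - sgdStep gradF γ (Y p.1, p.2) :=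
        (hstep.comp (by fun_prop)).sub (hstep.comp (by fun_prop))
      exact (eLpNorm_comp_measurePreserving h2.aestronglyMeasurable hS).trans_le h1
  obtain ⟨X, hX, -⟩ := hT.exists_fixedPoint 0 (edist_ne_top _ _)
  have hXm := (Lp.stronglyMeasurable X).measurable
  have hfix : (fun ω : ℕ → Z => sgdStep gradF γ (X (fun n => ω (n + 1)), ω 0)) =ᵐ[m] X := by
    have h1 := (hmem X).coeFn_toLp
    have h2 : (hmem X).toLp _ = X := hX
    rw [h2] at h1
    exact h1.symm
  refine ⟨m.map X, (isStationaryLaw_iff h.measurable γ).2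
    ⟨Measure.isProbabilityMeasure_map hXm.aemeasurable, ?_⟩⟩
  have h2 : (m.map X).prod P = (m.prod P).map (Prod.map X id) := by
    rw [← Measure.map_prod_map _ _ hXm measurable_id, Measure.map_id]
  rw [h2, Measure.map_map hstep (hXm.prodMap measurable_id), ← hS.map_eq,
    Measure.map_map (hstep.comp (hXm.prodMap measurable_id)) hS.measurable]
  exact Measure.map_congr hfix

/-- Synchronous coupling of the `k`-th iterate with a stationary law. -/
theorem exists_coupling (h : CocoerciveNoise P gradF g a μ L) (hγ : 0 < γ)
    (hγL : γ * L ≤ 1 / 2) {π : Measure (EuclideanSpace ℝ (Fin d))}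
    (hπ : IsStationaryLaw P gradF γ π) (ν : Measure (EuclideanSpace ℝ (Fin d)))
    [IsProbabilityMeasure ν] (k : ℕ) :
    ∃ κ : Measure (EuclideanSpace ℝ (Fin d) × EuclideanSpace ℝ (Fin d)),
      IsProbabilityMeasure κ ∧ κ.map Prod.fst = (sgdLaw P ν).map (sgdIterate gradF γ k) ∧
      κ.map Prod.snd = π ∧ eLpNorm (fun p => p.1 - p.2) 2 κ ≤
        ENNReal.ofReal √(1 - γ * μ) ^ k * eLpNorm (fun p => p.1 - p.2) 2 (ν.prod π) := by
  have := hπ.1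
  have hstep := measurable_sgdStep h.measurable γ
  induction k with
  | zero =>
    -- The coupling starts independent; afterwards a common noise moves both points, and
    -- stationarity keeps the second marginal equal to `π`.
    refine ⟨ν.prod π, inferInstance, ?_, ?_, by simp⟩
    · rw [sgdLaw_map_sgdIterate_zero, Measure.map_fst_prod, measure_univ, one_smul]
    · rw [Measure.map_snd_prod, measure_univ, one_smul]
  | succ k ih =>
    obtain ⟨κ, hκ, h1, h2, h3⟩ := ih
    let F : (EuclideanSpace ℝ (Fin d) × EuclideanSpace ℝ (Fin d)) × Z →
      EuclideanSpace ℝ (Fin d) × EuclideanSpace ℝ (Fin d) :=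
      fun p => (sgdStep gradF γ (p.1.1, p.2), sgdStep gradF γ (p.1.2, p.2))
    have hF1 : Measurable fun p : (EuclideanSpace ℝ (Fin d) × EuclideanSpace ℝ (Fin d)) × Z =>
      sgdStep gradF γ (p.1.1, p.2) := hstep.comp (by fun_prop)
    have hF2 : Measurable fun p : (EuclideanSpace ℝ (Fin d) × EuclideanSpace ℝ (Fin d)) × Z =>
      sgdStep gradF γ (p.1.2, p.2) := hstep.comp (by fun_prop)
    have hF : Measurable F := hF1.prodMk hF2
    have hprod : ∀ {pr : EuclideanSpace ℝ (Fin d) × EuclideanSpace ℝ (Fin d) →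
        EuclideanSpace ℝ (Fin d)} (_ : Measurable pr),
        (κ.prod P).map (fun p => sgdStep gradF γ (pr p.1, p.2)) =
          ((κ.map pr).prod P).map (sgdStep gradF γ) := fun {pr} hpr => by
      have : (κ.map pr).prod P = (κ.prod P).map (Prod.map pr id) := by
        rw [← Measure.map_prod_map _ _ hpr measurable_id, Measure.map_id]
      rw [this, Measure.map_map hstep (hpr.prodMap measurable_id)]
      rfl
    refine ⟨(κ.prod P).map F, Measure.isProbabilityMeasure_map hF.aemeasurable, ?_, ?_, ?_⟩
    · rw [Measure.map_map measurable_fst hF, sgdLaw_map_sgdIterate_succ h.measurable, ← h1,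
        ← hprod measurable_fst]
      rfl
    · conv_rhs => rw [← ((isStationaryLaw_iff h.measurable γ).1 hπ).2, ← h2]
      rw [Measure.map_map measurable_snd hF, ← hprod measurable_snd]
      rfl
    · rw [eLpNorm_map_measure (by fun_prop) hF.aemeasurable, pow_succ', mul_assoc]
      refine (h.eLpNorm_sgdStep_sub_le hγ hγL κ measurable_fst measurable_snd).trans ?_
      gcongr

theorem memLp_id_sgdIterate (h : CocoerciveNoise P gradF g a μ L) (hγ : 0 < γ)
    (hγL : γ * L ≤ 1 / 2) {ν : Measure (EuclideanSpace ℝ (Fin d))} [IsProbabilityMeasure ν]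
    (hν : MemLp (fun x => x) 2 ν) (k : ℕ) :
    MemLp (fun x => x) 2 ((sgdLaw P ν).map (sgdIterate gradF γ k)) := by
  induction k with
  | zero => rwa [sgdLaw_map_sgdIterate_zero]
  | succ k ih =>
    have : IsProbabilityMeasure ((sgdLaw P ν).map (sgdIterate gradF γ k)) :=
      Measure.isProbabilityMeasure_map (measurable_sgdIterate h.measurable γ k).aemeasurable
    rw [sgdLaw_map_sgdIterate_succ h.measurable, memLp_map_measure_iff (by fun_prop)
      (measurable_sgdStep h.measurable γ).aemeasurable]
    exact h.memLp_sgdStep hγ hγL _ measurable_id ih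

theorem integrable_sgdIterate (h : CocoerciveNoise P gradF g a μ L) (hγ : 0 < γ)
    (hγL : γ * L ≤ 1 / 2) {ν : Measure (EuclideanSpace ℝ (Fin d))} [IsProbabilityMeasure ν]
    (hν : MemLp (fun x => x) 2 ν) (k : ℕ) :
    Integrable (sgdIterate gradF γ k) (sgdLaw P ν) :=
  ((h.memLp_id_sgdIterate hγ hγL hν k).comp_of_map
    (measurable_sgdIterate h.measurable γ k).aemeasurable).integrable one_le_two

theorem eLpNorm_sub_lt_top {π ν : Measure (EuclideanSpace ℝ (Fin d))} [IsProbabilityMeasure π]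
    [IsProbabilityMeasure ν] (hν : MemLp (fun x => x) 2 ν) (hπ : MemLp (fun x => x) 2 π) :
    eLpNorm (fun p : EuclideanSpace ℝ (Fin d) × EuclideanSpace ℝ (Fin d) => p.1 - p.2) 2
      (ν.prod π) < ∞ :=
  ((hν.comp_measurePreserving measurePreserving_fst).sub
    (hπ.comp_measurePreserving measurePreserving_snd)).eLpNorm_lt_top

/-- Stationary laws with finite second moment are unique. -/
theorem isStationaryLaw_unique (h : CocoerciveNoise P gradF g a μ L) (hγ : 0 < γ)
    (hγL : γ * L ≤ 1 / 2) {π π' : Measure (EuclideanSpace ℝ (Fin d))}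
    (hπ : IsStationaryLaw P gradF γ π) (hπ' : IsStationaryLaw P gradF γ π')
    (hm : MemLp (fun x => x) 2 π) (hm' : MemLp (fun x => x) 2 π') : π' = π := by
  have := hπ.1
  have := hπ'.1
  refine Measure.ext_of_charFun (funext fun t => ?_)
  -- Started from `π'`, the coupling has marginals `π'` and `π` at every time `k`, while `x ↦
  -- exp(i⟨x, t⟩)` is `‖t‖`-Lipschitz; the left side does not depend on `k` and the right side tends
  -- to 0.
  have hbound : ∀ k : ℕ, ‖charFun π' t - charFun π t‖ₑ ≤ ENNReal.ofReal √(1 - γ * μ) ^ k *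
      (‖t‖ₑ * eLpNorm (fun p : EuclideanSpace ℝ (Fin d) × EuclideanSpace ℝ (Fin d) => p.1 - p.2) 2
        (π'.prod π)) := fun k => by
    obtain ⟨κ, hκ, h1, h2, h3⟩ := h.exists_coupling hγ hγL hπ π' k
    rw [hπ'.sgdLaw_map_sgdIterate h.measurable] at h1
    have hc : Continuous fun x : EuclideanSpace ℝ (Fin d) =>
      Complex.exp (inner ℝ x t * Complex.I) := by fun_prop
    have hn : ∀ x : EuclideanSpace ℝ (Fin d), ‖Complex.exp (inner ℝ x t * Complex.I)‖ ≤ 1 :=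
      fun x => (Complex.norm_exp_ofReal_mul_I _).le
    have hi1 : Integrable (fun p : EuclideanSpace ℝ (Fin d) × EuclideanSpace ℝ (Fin d) =>
        Complex.exp (inner ℝ p.1 t * Complex.I)) κ :=
      .of_bound (hc.comp continuous_fst).aestronglyMeasurable 1
        (Filter.Eventually.of_forall fun p => hn p.1)
    have hi2 : Integrable (fun p : EuclideanSpace ℝ (Fin d) × EuclideanSpace ℝ (Fin d) =>
        Complex.exp (inner ℝ p.2 t * Complex.I)) κ :=
      .of_bound (hc.comp continuous_snd).aestronglyMeasurable 1
        (Filter.Eventually.of_forall fun p => hn p.2)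
    conv_lhs => rw [charFun_apply, charFun_apply, ← h1, ← h2]
    rw [integral_map measurable_fst.aemeasurable hc.aestronglyMeasurable,
      integral_map measurable_snd.aemeasurable hc.aestronglyMeasurable, ← integral_sub hi1 hi2]
    calc _ ≤ ∫⁻ p, ‖Complex.exp (inner ℝ p.1 t * Complex.I) -
            Complex.exp (inner ℝ p.2 t * Complex.I)‖ₑ ∂κ := enorm_integral_le_lintegral_enorm _
      _ ≤ ∫⁻ p, ‖t‖ₑ * ‖p.1 - p.2‖ₑ ∂κ := by
          refine lintegral_mono fun p => ?_
          rw [← enorm_norm t, ← enorm_norm (p.1 - p.2), ← enorm_mul, enorm_le_iff_norm_le]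
          have e : Complex.exp (inner ℝ p.1 t * Complex.I) -
              Complex.exp (inner ℝ p.2 t * Complex.I) =
              Complex.exp (inner ℝ p.2 t * Complex.I) *
                (Complex.exp (Complex.I * (inner ℝ (p.1 - p.2) t : ℝ)) - 1) := by
            rw [mul_sub, ← Complex.exp_add, inner_sub_left]
            push_cast
            ring_nf
          rw [e, norm_mul, Complex.norm_exp_ofReal_mul_I, one_mul]
          refine Real.norm_exp_I_mul_ofReal_sub_one_le.trans ?_
          refine (norm_inner_le_norm _ _).trans (le_of_eq ?_)
          rw [norm_mul, norm_norm, norm_norm, mul_comm]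
      _ = ‖t‖ₑ * eLpNorm (fun p => p.1 - p.2) 1 κ := by
          rw [lintegral_const_mul _ (by fun_prop), eLpNorm_one_eq_lintegral_enorm]
      _ ≤ ‖t‖ₑ * eLpNorm (fun p => p.1 - p.2) 2 κ := by
          gcongr
          exact eLpNorm_le_eLpNorm_of_exponent_le one_le_two (by fun_prop)
      _ ≤ _ := by
          rw [mul_left_comm]
          gcongr
  have hlim := ENNReal.Tendsto.mul_const (b := ‖t‖ₑ * eLpNorm (fun p : EuclideanSpace ℝ (Fin d) ×
      EuclideanSpace ℝ (Fin d) => p.1 - p.2) 2 (π'.prod π))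
    (ENNReal.tendsto_pow_atTop_nhds_zero_of_lt_one (r := ENNReal.ofReal √(1 - γ * μ)) (by
      rw [ENNReal.ofReal_lt_one]
      exact sqrt_one_sub_lt_one (mul_pos hγ h.mu_pos)))
    (Or.inr (ENNReal.mul_ne_top enorm_ne_top (eLpNorm_sub_lt_top hm' hm).ne))
  rw [zero_mul] at hlim
  have h0 := ge_of_tendsto' hlim hbound
  rwa [nonpos_iff_eq_zero, enorm_eq_zero, sub_eq_zero] at h0

/-- Geometric convergence of the mean of the iterates. -/
theorem norm_integral_sgdIterate_sub_le (h : CocoerciveNoise P gradF g a μ L) (hγ : 0 < γ)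
    (hγL : γ * L ≤ 1 / 2) {π ν : Measure (EuclideanSpace ℝ (Fin d))} [IsProbabilityMeasure ν]
    (hπ : IsStationaryLaw P gradF γ π) (hm : MemLp (fun x => x) 2 π)
    (hν : MemLp (fun x => x) 2 ν) (k : ℕ) :
    ‖∫ ω, sgdIterate gradF γ k ω ∂(sgdLaw P ν) - ∫ x, x ∂π‖ ≤
      √(1 - γ * μ) ^ k * (√(∫ x, ‖x - a‖ ^ 2 ∂ν) + √(∫ x, ‖x - a‖ ^ 2 ∂π)) := by
  have := hπ.1
  obtain ⟨κ, hκ, h1, h2, h3⟩ := h.exists_coupling hγ hγL hπ ν k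
  have hk := measurable_sgdIterate h.measurable γ k
  have e1 : ∫ ω, sgdIterate gradF γ k ω ∂(sgdLaw P ν) = ∫ p, p.1 ∂κ := by
    rw [← integral_map (f := fun x => x) hk.aemeasurable (by fun_prop), ← h1,
      integral_map (f := fun x => x) measurable_fst.aemeasurable (by fun_prop)]
  have e2 : ∫ x, x ∂π = ∫ p, p.2 ∂κ := by
    rw [← h2, integral_map (f := fun x => x) measurable_snd.aemeasurable (by fun_prop)]
  have i1 : Integrable (fun p : EuclideanSpace ℝ (Fin d) × EuclideanSpace ℝ (Fin d) => p.1) κ := by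
    have := h.memLp_id_sgdIterate hγ hγL hν k
    rw [← h1] at this
    exact (this.comp_of_map measurable_fst.aemeasurable).integrable one_le_two
  have i2 : Integrable (fun p : EuclideanSpace ℝ (Fin d) × EuclideanSpace ℝ (Fin d) => p.2) κ := by
    rw [← h2] at hm
    exact (hm.comp_of_map measurable_snd.aemeasurable).integrable one_le_two
  have hνa : MemLp (fun x => x - a) 2 ν := hν.sub (memLp_const a)
  have hπa : MemLp (fun x => x - a) 2 π := hm.sub (memLp_const a)
  rw [← ENNReal.ofReal_le_ofReal_iff (by positivity), ofReal_norm, e1, e2, ← integral_sub i1 i2]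
  calc _ ≤ eLpNorm (fun p => p.1 - p.2) 1 κ := by
        rw [eLpNorm_one_eq_lintegral_enorm]
        exact enorm_integral_le_lintegral_enorm _
    _ ≤ eLpNorm (fun p => p.1 - p.2) 2 κ :=
        eLpNorm_le_eLpNorm_of_exponent_le one_le_two (by fun_prop)
    _ ≤ ENNReal.ofReal √(1 - γ * μ) ^ k * eLpNorm (fun p => p.1 - p.2) 2 (ν.prod π) := h3
    _ ≤ ENNReal.ofReal √(1 - γ * μ) ^ k * (eLpNorm (fun x => x - a) 2 ν +
          eLpNorm (fun x => x - a) 2 π) := by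
        gcongr
        rw [← eLpNorm_comp_measurePreserving hνa.1 (measurePreserving_fst (μ := ν) (ν := π)),
          ← eLpNorm_comp_measurePreserving hπa.1 (measurePreserving_snd (μ := ν) (ν := π))]
        refine le_trans (le_of_eq ?_) (eLpNorm_sub_le
          (hνa.comp_measurePreserving measurePreserving_fst).1
          (hπa.comp_measurePreserving measurePreserving_snd).1 one_le_two)
        congr 1
        ext1 p
        simp
    _ = _ := by
        rw [hνa.eLpNorm_two_eq_sqrt, hπa.eLpNorm_two_eq_sqrt, ← ENNReal.ofReal_add (by positivity)
          (by positivity), ← ENNReal.ofReal_pow (by positivity), ENNReal.ofReal_mul (by positivity)]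

end CocoerciveNoise

end Stationary

/-! ### Stationarity identities and moment bounds -/

theorem MeasureTheory.MemLp.integrable_inner_of_two {Ω E : Type*} [MeasurableSpace Ω]
    [NormedAddCommGroup E] [InnerProductSpace ℝ E] {m : Measure Ω} {X Y : Ω → E}
    (hX : MemLp X 2 m) (hY : MemLp Y 2 m) : Integrable (fun ω => inner ℝ (X ω) (Y ω)) m :=
  (hX.norm.integrable_mul hY.norm).mono' (hX.1.inner hY.1)
    (Filter.Eventually.of_forall fun _ => norm_inner_le_norm _ _)

theorem abs_inner_apply_le {E : Type*} [NormedAddCommGroup E] [InnerProductSpace ℝ E]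
    (G : E →L[ℝ] E) (u v : E) : |inner ℝ u (G v)| ≤ ‖G‖ * (‖u‖ * ‖v‖) := by
  refine (abs_real_inner_le_norm _ _).trans ?_
  calc _ ≤ ‖u‖ * (‖G‖ * ‖v‖) := by gcongr; exact G.le_opNorm v
    _ = _ := by ring

/-- Powers of a nonnegative number, controlled by its sixth power at scale `s`. -/
theorem pow_le_of_sixth {s t : ℝ} (hs : 0 < s) (ht : 0 ≤ t) {k : ℕ} (hk : k ≤ 6) :
    t ^ k ≤ s ^ k * (1 + t ^ 6 / s ^ 6) := by
  rw [← div_le_iff₀' (by positivity), ← div_pow, ← div_pow]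
  have h0 : 0 ≤ t / s := by positivity
  rcases le_total (t / s) 1 with h | h
  · have := pow_le_one₀ (n := k) h0 h
    have := pow_nonneg h0 6
    linarith
  · have := pow_le_pow_right₀ h hk
    linarith

section Expansion

variable {d : ℕ} {Z : Type*} [MeasurableSpace Z] {P : Measure Z} [IsProbabilityMeasure P]
  {gradF : EuclideanSpace ℝ (Fin d) → Z → EuclideanSpace ℝ (Fin d)}
  {g : EuclideanSpace ℝ (Fin d) → EuclideanSpace ℝ (Fin d)} {a : EuclideanSpace ℝ (Fin d)}
  {μ L γ : ℝ} {π : Measure (EuclideanSpace ℝ (Fin d))}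

theorem IsStationaryLaw.integral_eq {V : Type*} [NormedAddCommGroup V] [NormedSpace ℝ V]
    (h : Measurable (Function.uncurry gradF))
    (hπ : IsStationaryLaw P gradF γ π) {φ : EuclideanSpace ℝ (Fin d) → V} (hφ : Continuous φ) :
    ∫ p, φ (sgdStep gradF γ p) ∂(π.prod P) = ∫ x, φ x ∂π := by
  conv_rhs => rw [← ((isStationaryLaw_iff h γ).1 hπ).2]
  have : SecondCountableTopologyEither (EuclideanSpace ℝ (Fin d)) V := inferInstance
  rw [integral_map (measurable_sgdStep h γ).aemeasurable hφ.aestronglyMeasurable]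

namespace CocoerciveNoise

variable [IsProbabilityMeasure π]

theorem memLp_noise (h : CocoerciveNoise P gradF g a μ L) (hm : MemLp (fun x => x) 2 π) :
    MemLp (fun p : EuclideanSpace ℝ (Fin d) × Z => gradF p.1 p.2) 2 (π.prod P) :=
  h.memLp_gradF π measurable_id hm

/-- The noise is unbiased conditionally on the current iterate. -/
theorem integral_inner_noise (h : CocoerciveNoise P gradF g a μ L) (hm : MemLp (fun x => x) 2 π)
    {Y : EuclideanSpace ℝ (Fin d) → EuclideanSpace ℝ (Fin d)} (hY : MemLp Y 2 π) :
    ∫ p, inner ℝ (Y p.1) (gradF p.1 p.2) ∂(π.prod P) = ∫ x, inner ℝ (Y x) (g x) ∂π := by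
  have hi : Integrable (fun p : EuclideanSpace ℝ (Fin d) × Z => inner ℝ (Y p.1) (gradF p.1 p.2))
      (π.prod P) :=
    (hY.comp_measurePreserving measurePreserving_fst).integrable_inner_of_two (h.memLp_noise hm)
  rw [integral_prod _ hi]
  refine integral_congr_ae (Filter.Eventually.of_forall fun x => ?_)
  simp only [integral_inner (h.integrable x), h.unbiased]

/-- The mean gradient vanishes under a stationary law. -/
theorem integral_mean_eq_zero (h : CocoerciveNoise P gradF g a μ L) (hγ : 0 < γ)
    (hπ : IsStationaryLaw P gradF γ π) (hm : MemLp (fun x => x) 2 π) : ∫ x, g x ∂π = 0 := by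
  have h1 := hπ.integral_eq h.measurable (φ := fun x => x) continuous_id
  have hF := (h.memLp_noise hm).integrable one_le_two
  have hx := (hm.comp_measurePreserving (measurePreserving_fst (ν := P))).integrable one_le_two
  have h2 : ∫ p : EuclideanSpace ℝ (Fin d) × Z, p.1 ∂(π.prod P) = ∫ x, x ∂π := by
    rw [← integral_map (f := fun x => x) measurable_fst.aemeasurable (by fun_prop),
      Measure.map_fst_prod, measure_univ, one_smul]
  have h3 : ∫ p, sgdStep gradF γ p ∂(π.prod P) =
      ∫ x, x ∂π - γ • ∫ p, gradF p.1 p.2 ∂(π.prod P) := by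
    rw [← h2, ← integral_smul]
    exact integral_sub hx (hF.smul γ)
  rw [h3, sub_eq_self, smul_eq_zero_iff_right hγ.ne', integral_prod _ hF] at h1
  simpa only [h.unbiased] using h1

/-- Stationarity of quadratic forms. -/
theorem integral_quadratic (h : CocoerciveNoise P gradF g a μ L) (hγ : 0 < γ)
    (hπ : IsStationaryLaw P gradF γ π) (hm : MemLp (fun x => x) 2 π)
    (G : EuclideanSpace ℝ (Fin d) →L[ℝ] EuclideanSpace ℝ (Fin d)) :
    ∫ x, (inner ℝ (g x) (G (x - a)) + inner ℝ (x - a) (G (g x))) ∂π =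
      γ * ∫ p, inner ℝ (gradF p.1 p.2) (G (gradF p.1 p.2)) ∂(π.prod P) := by
  have hF := h.memLp_noise hm
  have hxa : MemLp (fun x => x - a) 2 π := hm.sub (memLp_const a)
  have hx : MemLp (fun p : EuclideanSpace ℝ (Fin d) × Z => p.1 - a) 2 (π.prod P) :=
    hxa.comp_measurePreserving measurePreserving_fst
  have hGx := G.comp_memLp' hxa
  have hG'x := G.adjoint.comp_memLp' hxa
  have i1 := hx.integrable_inner_of_two (G.comp_memLp' hx)
  have i2 := (G.comp_memLp' hx).integrable_inner_of_two hF
  have i3 := (G.adjoint.comp_memLp' hx).integrable_inner_of_two hF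
  have i4 := hF.integrable_inner_of_two (G.comp_memLp' hF)
  have e2 := h.integral_inner_noise hm hGx
  have e3 := h.integral_inner_noise hm hG'x
  simp only [Function.comp_apply] at i1 i2 i3 i4 e2 e3
  -- After one step is expanded, the terms of order zero in `γ` cancel; dividing the rest by `γ`
  -- gives the identity.
  have h1 := hπ.integral_eq h.measurable (φ := fun x => inner ℝ (x - a) (G (x - a)))
    (by fun_prop)
  have h2 : ∫ p : EuclideanSpace ℝ (Fin d) × Z, inner ℝ (p.1 - a) (G (p.1 - a)) ∂(π.prod P) =
      ∫ x, inner ℝ (x - a) (G (x - a)) ∂π := by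
    rw [← integral_map (f := fun x => inner ℝ (x - a) (G (x - a))) measurable_fst.aemeasurable
      (by fun_prop), Measure.map_fst_prod, measure_univ, one_smul]
  have e : ∀ p : EuclideanSpace ℝ (Fin d) × Z,
      inner ℝ (sgdStep gradF γ p - a) (G (sgdStep gradF γ p - a)) =
      inner ℝ (p.1 - a) (G (p.1 - a)) - γ * (inner ℝ (G (p.1 - a)) (gradF p.1 p.2) +
        inner ℝ (G.adjoint (p.1 - a)) (gradF p.1 p.2)) +
        γ ^ 2 * inner ℝ (gradF p.1 p.2) (G (gradF p.1 p.2)) := fun p => by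
    have : sgdStep gradF γ p - a = (p.1 - a) - γ • gradF p.1 p.2 := by
      simp only [sgdStep]; abel
    rw [this, map_sub, map_smul, inner_sub_left, inner_sub_right, inner_sub_right,
      ContinuousLinearMap.adjoint_inner_left, real_inner_comm (gradF p.1 p.2) (G (p.1 - a))]
    simp only [inner_smul_left, inner_smul_right, conj_trivial]
    ring
  have i23 : Integrable (fun p : EuclideanSpace ℝ (Fin d) × Z =>
      γ * (inner ℝ (G (p.1 - a)) (gradF p.1 p.2) +
        inner ℝ (G.adjoint (p.1 - a)) (gradF p.1 p.2))) (π.prod P) := (i2.add i3).const_mul γ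
  have i123 := i1.sub i23
  simp only [Pi.sub_def] at i123
  simp_rw [e] at h1
  rw [integral_add i123 (i4.const_mul _), integral_sub i1 i23, integral_const_mul,
    integral_const_mul, integral_add i2 i3, e2, e3, h2] at h1
  have j2 := hGx.integrable_inner_of_two (h.memLp_mean hm)
  have j3 := hG'x.integrable_inner_of_two (h.memLp_mean hm)
  simp only [Function.comp_apply] at j2 j3
  rw [← integral_add j2 j3] at h1
  have h3 : ∫ x, (inner ℝ (g x) (G (x - a)) + inner ℝ (x - a) (G (g x))) ∂π =
      ∫ x, (inner ℝ (G (x - a)) (g x) + inner ℝ (G.adjoint (x - a)) (g x)) ∂π := by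
    refine integral_congr_ae (Filter.Eventually.of_forall fun x => ?_)
    simp only [ContinuousLinearMap.adjoint_inner_left, real_inner_comm (g x) (G (x - a))]
  rw [h3]
  refine mul_left_cancel₀ hγ.ne' ?_
  linarith

/-- The noise increment with respect to the optimum, in mean square. -/
theorem integral_noise_sub_sq_le (h : CocoerciveNoise P gradF g a μ L)
    (hm : MemLp (fun x => x) 2 π) :
    Integrable (fun p : EuclideanSpace ℝ (Fin d) × Z => ‖gradF p.1 p.2 - gradF a p.2‖ ^ 2)
      (π.prod P) ∧
    ∫ p, ‖gradF p.1 p.2 - gradF a p.2‖ ^ 2 ∂(π.prod P) ≤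
      L * ∫ x, inner ℝ (x - a) (g x) ∂π := by
  have hD : MemLp (fun p : EuclideanSpace ℝ (Fin d) × Z => gradF p.1 p.2 - gradF a p.2) 2
      (π.prod P) :=
    (h.memLp_noise hm).sub (h.memLp.comp_measurePreserving measurePreserving_snd)
  have hD2 := hD.integrable_norm_pow two_ne_zero
  have hi : Integrable (fun x => inner ℝ (x - a) (g x)) π :=
    (hm.sub (memLp_const a)).integrable_inner_of_two (h.memLp_mean hm)
  refine ⟨hD2, ?_⟩
  rw [← integral_const_mul, integral_prod _ hD2]
  refine integral_mono hD2.integral_prod_left (hi.const_mul L) fun x => ?_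
  have := h.integral_norm_sub_sq_le x a
  rwa [h.zero, sub_zero, real_inner_comm] at this

/-- The second moment of a stationary law. -/
theorem integral_norm_sub_sq_stationary_le (h : CocoerciveNoise P gradF g a μ L) (hγ : 0 < γ)
    (hγL : γ * L ≤ 1 / 2) (hπ : IsStationaryLaw P gradF γ π) (hm : MemLp (fun x => x) 2 π)
    {τ : ℝ} (hτ : ∫ z, ‖gradF a z‖ ^ 2 ∂P ≤ τ ^ 2) :
    ∫ x, ‖x - a‖ ^ 2 ∂π ≤ 2 * γ * τ ^ 2 / μ := by
  -- With `I = ∫ ⟨x - a, g x⟩ dπ`, this reads `2 I = γ E‖∇F‖² ≤ 2γL I + 2γτ²`; as `γ * L ≤ 1 / 2`,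
  -- it follows that `I ≤ 2γτ²`.
  have h1 := h.integral_quadratic hγ hπ hm (ContinuousLinearMap.id ℝ _)
  obtain ⟨hD, h2⟩ := h.integral_noise_sub_sq_le hm
  have hxa : MemLp (fun x => x - a) 2 π := hm.sub (memLp_const a)
  have hi : Integrable (fun x => inner ℝ (x - a) (g x)) π :=
    hxa.integrable_inner_of_two (h.memLp_mean hm)
  have hs : MemLp (fun p : EuclideanSpace ℝ (Fin d) × Z => gradF a p.2) 2 (π.prod P) :=
    h.memLp.comp_measurePreserving measurePreserving_snd
  have hs2 := hs.integrable_norm_pow two_ne_zero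
  have hsv : ∫ p : EuclideanSpace ℝ (Fin d) × Z, ‖gradF a p.2‖ ^ 2 ∂(π.prod P) =
      ∫ z, ‖gradF a z‖ ^ 2 ∂P := by
    rw [integral_fun_snd (f := fun z => ‖gradF a z‖ ^ 2)]; simp
  have hF2 := (h.memLp_noise hm).integrable_norm_pow two_ne_zero
  simp only [ContinuousLinearMap.id_apply, real_inner_self_eq_norm_sq] at h1
  have h3 : ∫ x, (inner ℝ (g x) (x - a) + inner ℝ (x - a) (g x)) ∂π =
      2 * ∫ x, inner ℝ (x - a) (g x) ∂π := by
    rw [← integral_const_mul]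
    refine integral_congr_ae (Filter.Eventually.of_forall fun x => ?_)
    simp only [real_inner_comm (x - a) (g x)]
    ring
  have h4 : ∫ p, ‖gradF p.1 p.2‖ ^ 2 ∂(π.prod P) ≤
      2 * ∫ p, ‖gradF p.1 p.2 - gradF a p.2‖ ^ 2 ∂(π.prod P) +
      2 * ∫ z, ‖gradF a z‖ ^ 2 ∂P := by
    rw [← hsv, ← integral_const_mul, ← integral_const_mul,
      ← integral_add (hD.const_mul 2) (hs2.const_mul 2)]
    refine integral_mono hF2 ((hD.const_mul 2).add (hs2.const_mul 2)) fun p => ?_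
    have h5 := norm_add_le (gradF p.1 p.2 - gradF a p.2) (gradF a p.2)
    rw [sub_add_cancel] at h5
    have h6 := pow_le_pow_left₀ (norm_nonneg _) h5 2
    beta_reduce
    nlinarith [sq_nonneg (‖gradF p.1 p.2 - gradF a p.2‖ - ‖gradF a p.2‖)]
  have h5 : μ * ∫ x, ‖x - a‖ ^ 2 ∂π ≤ ∫ x, inner ℝ (x - a) (g x) ∂π := by
    rw [← integral_const_mul]
    refine integral_mono ((hxa.integrable_norm_pow two_ne_zero).const_mul μ) hi fun x => ?_
    have := h.strongly_monotone x a
    rwa [h.zero, sub_zero, real_inner_comm] at this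
  rw [h3] at h1
  have hμ := h.mu_pos
  have h6 : 0 ≤ ∫ x, ‖x - a‖ ^ 2 ∂π := integral_nonneg fun x => by positivity
  rw [le_div_iff₀ hμ]
  set I := ∫ x, inner ℝ (x - a) (g x) ∂π
  have hI : 0 ≤ I := (mul_nonneg hμ.le h6).trans h5
  have h7 : γ * (L * I) ≤ 1 / 2 * I := by
    rw [← mul_assoc]; exact mul_le_mul_of_nonneg_right hγL hI
  nlinarith

/-- Replacing the noise by its value at the optimum in a quadratic form. -/
theorem abs_integral_quadratic_sub_le (h : CocoerciveNoise P gradF g a μ L)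
    (hm : MemLp (fun x => x) 2 π)
    (G : EuclideanSpace ℝ (Fin d) →L[ℝ] EuclideanSpace ℝ (Fin d)) {s τ : ℝ} (hs : 0 < s)
    (hτ : ∫ z, ‖gradF a z‖ ^ 2 ∂P ≤ τ ^ 2) :
    |∫ p, inner ℝ (gradF p.1 p.2) (G (gradF p.1 p.2)) ∂(π.prod P) -
      ∫ z, inner ℝ (gradF a z) (G (gradF a z)) ∂P| ≤
      ‖G‖ * ((1 + 1 / s) * (L ^ 2 * ∫ x, ‖x - a‖ ^ 2 ∂π) + s * τ ^ 2) := by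
  obtain ⟨hD, h2⟩ := h.integral_noise_sub_sq_le hm
  have hF := h.memLp_noise hm
  have hxa : MemLp (fun x => x - a) 2 π := hm.sub (memLp_const a)
  have hst : MemLp (fun p : EuclideanSpace ℝ (Fin d) × Z => gradF a p.2) 2 (π.prod P) :=
    h.memLp.comp_measurePreserving measurePreserving_snd
  have hs2 := hst.integrable_norm_pow two_ne_zero
  have hsv : ∫ p : EuclideanSpace ℝ (Fin d) × Z, ‖gradF a p.2‖ ^ 2 ∂(π.prod P) =
      ∫ z, ‖gradF a z‖ ^ 2 ∂P := by
    rw [integral_fun_snd (f := fun z => ‖gradF a z‖ ^ 2)]; simp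
  have hsG : ∫ p : EuclideanSpace ℝ (Fin d) × Z, inner ℝ (gradF a p.2) (G (gradF a p.2))
      ∂(π.prod P) = ∫ z, inner ℝ (gradF a z) (G (gradF a z)) ∂P := by
    rw [integral_fun_snd (f := fun z => inner ℝ (gradF a z) (G (gradF a z)))]; simp
  have i1 := hF.integrable_inner_of_two (G.comp_memLp' hF)
  have i2 := hst.integrable_inner_of_two (G.comp_memLp' hst)
  simp only [Function.comp_apply] at i1 i2
  have h3 : ∫ p, ‖gradF p.1 p.2 - gradF a p.2‖ ^ 2 ∂(π.prod P) ≤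
      L ^ 2 * ∫ x, ‖x - a‖ ^ 2 ∂π := by
    refine h2.trans ?_
    rw [pow_two L, mul_assoc]
    refine mul_le_mul_of_nonneg_left ?_ h.L_pos.le
    rw [← integral_const_mul]
    refine integral_mono (hxa.integrable_inner_of_two (h.memLp_mean hm))
      ((hxa.integrable_norm_pow two_ne_zero).const_mul L) fun x => ?_
    refine (real_inner_le_norm _ _).trans ?_
    have := mul_le_mul_of_nonneg_left (h.norm_mean_le x) (norm_nonneg (x - a))
    beta_reduce
    linarith
  rw [← hsG, ← integral_sub i1 i2]
  refine abs_integral_le_integral_abs.trans ?_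
  calc _ ≤ ∫ p, ‖G‖ * ((1 + 1 / s) * ‖gradF p.1 p.2 - gradF a p.2‖ ^ 2 + s * ‖gradF a p.2‖ ^ 2)
        ∂(π.prod P) := by
        refine integral_mono (i1.sub i2).abs
          (((hD.const_mul _).add (hs2.const_mul s)).const_mul _) fun p => ?_
        set u := gradF p.1 p.2
        set v := gradF a p.2
        have e : inner ℝ u (G u) - inner ℝ v (G v) = inner ℝ (u - v) (G (u - v)) +
            (inner ℝ (u - v) (G v) + inner ℝ v (G (u - v))) := by
          simp only [map_sub, inner_sub_left, inner_sub_right]; ring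
        have a1 := abs_inner_apply_le G (u - v) (u - v)
        have a2 := abs_inner_apply_le G (u - v) v
        have a3 := abs_inner_apply_le G v (u - v)
        -- Weighted Young inequality. With `s = √γ` and a mean square of `u - v` of order `γ`, both
        -- terms are of order `√γ`.
        have a4 : 2 * (‖u - v‖ * ‖v‖) ≤ 1 / s * ‖u - v‖ ^ 2 + s * ‖v‖ ^ 2 := by
          have : 0 ≤ 1 / s * (‖u - v‖ - s * ‖v‖) ^ 2 := by positivity
          have e2 : 1 / s * (‖u - v‖ - s * ‖v‖) ^ 2 =
            1 / s * ‖u - v‖ ^ 2 + s * ‖v‖ ^ 2 - 2 * (‖u - v‖ * ‖v‖) := by field_simp; ring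
          linarith
        calc _ ≤ |inner ℝ (u - v) (G (u - v))| +
              (|inner ℝ (u - v) (G v)| + |inner ℝ v (G (u - v))|) := by
              rw [e]
              exact (abs_add_le _ _).trans (by gcongr; exact abs_add_le _ _)
          _ ≤ ‖G‖ * (‖u - v‖ ^ 2 + 2 * (‖u - v‖ * ‖v‖)) := by nlinarith
          _ ≤ _ := by
              refine mul_le_mul_of_nonneg_left ?_ (norm_nonneg _)
              linarith
    _ = ‖G‖ * ((1 + 1 / s) * ∫ p, ‖gradF p.1 p.2 - gradF a p.2‖ ^ 2 ∂(π.prod P) +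
          s * ∫ z, ‖gradF a z‖ ^ 2 ∂P) := by
        rw [integral_const_mul, integral_add (hD.const_mul _) (hs2.const_mul s),
          integral_const_mul, integral_const_mul, hsv]
    _ ≤ _ := by gcongr

end CocoerciveNoise

end Expansion

/-! ### Quadratic functionals and the Frobenius norm -/

noncomputable section

/-- The linear map `A ↦ ∫ ⟨X, A X⟩ dm`. -/
def quadraticMean {Ω E : Type*} [MeasurableSpace Ω] [NormedAddCommGroup E] [InnerProductSpace ℝ E]
    {m : Measure Ω} {X : Ω → E} (hX : MemLp X 2 m) : (E →L[ℝ] E) →ₗ[ℝ] ℝ where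
  toFun A := ∫ ω, inner ℝ (X ω) (A (X ω)) ∂m
  map_add' A B := by
    simp only [add_apply, inner_add_right]
    exact integral_add (hX.integrable_inner_of_two (A.comp_memLp' hX))
      (hX.integrable_inner_of_two (B.comp_memLp' hX))
  map_smul' c A := by
    simp only [smul_apply, inner_smul_right, RingHom.id_apply, smul_eq_mul, integral_const_mul]

/-- The matrix unit `x ↦ x_j e_i`. -/
def matrixUnit {d : ℕ} (i j : Fin d) : EuclideanSpace ℝ (Fin d) →L[ℝ] EuclideanSpace ℝ (Fin d) :=
  (EuclideanSpace.proj j : EuclideanSpace ℝ (Fin d) →L[ℝ] ℝ).smulRight (EuclideanSpace.single i 1)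

end

theorem inner_matrixUnit {d : ℕ} (i j : Fin d) (x : EuclideanSpace ℝ (Fin d)) :
    inner ℝ x (matrixUnit i j x) = x i * x j := by
  simp [matrixUnit, inner_smul_right, EuclideanSpace.inner_single_right, mul_comm]

theorem frobNorm_nonneg {d : ℕ} (A : Matrix (Fin d) (Fin d) ℝ) : 0 ≤ frobNorm A :=
  Real.sqrt_nonneg _

theorem frobNorm_sq {d : ℕ} (A : Matrix (Fin d) (Fin d) ℝ) :
    frobNorm A ^ 2 = ∑ i, ∑ j, A i j ^ 2 :=
  Real.sq_sqrt (by positivity)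

theorem frobNorm_smul {d : ℕ} (c : ℝ) (A : Matrix (Fin d) (Fin d) ℝ) :
    frobNorm (c • A) = |c| * frobNorm A := by
  simp only [frobNorm, Matrix.smul_apply, smul_eq_mul, mul_pow, ← Finset.mul_sum]
  rw [Real.sqrt_mul (sq_nonneg _), Real.sqrt_sq_eq_abs]

/-- The operator norm is at most the Frobenius norm. -/
theorem norm_sum_matrixUnit_le {d : ℕ} (A : Matrix (Fin d) (Fin d) ℝ) :
    ‖∑ i, ∑ j, A i j • matrixUnit i j‖ ≤ frobNorm A := by
  refine ContinuousLinearMap.opNorm_le_bound _ (frobNorm_nonneg A) fun x => ?_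
  have e : ∀ i, (∑ i, ∑ j, A i j • matrixUnit i j) x i = ∑ j, A i j * x j := fun i => by
    simp [matrixUnit, Finset.sum_apply, Pi.single_apply]
  refine abs_le_of_sq_le_sq' ?_ (by positivity [frobNorm_nonneg A]) |>.2
  rw [mul_pow, frobNorm_sq, EuclideanSpace.real_norm_sq_eq, EuclideanSpace.real_norm_sq_eq,
    Finset.sum_mul]
  refine Finset.sum_le_sum fun i _ => ?_
  rw [e]
  exact Finset.sum_mul_sq_le_sq_mul_sq _ _ _

/-- A functional bounded in operator norm has a bounded matrix in Frobenius norm. -/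
theorem frobNorm_matrixUnit_le {d : ℕ}
    (Ψ : (EuclideanSpace ℝ (Fin d) →L[ℝ] EuclideanSpace ℝ (Fin d)) →ₗ[ℝ] ℝ) {c : ℝ}
    (hΨ : ∀ A, |Ψ A| ≤ c * ‖A‖) (hc : 0 ≤ c) :
    frobNorm (Matrix.of fun i j => Ψ (matrixUnit i j)) ≤ c := by
  set B : Matrix (Fin d) (Fin d) ℝ := Matrix.of fun i j => Ψ (matrixUnit i j) with hB
  -- Duality: the functional is tested on the operator of its own matrix, whose operator norm is at
  -- most `frobNorm B`.
  have h1 : Ψ (∑ i, ∑ j, B i j • matrixUnit i j) = frobNorm B ^ 2 := by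
    rw [frobNorm_sq]
    simp [hB, map_sum, pow_two]
  have h2 := (le_abs_self _).trans (hΨ (∑ i, ∑ j, B i j • matrixUnit i j))
  rw [h1] at h2
  have h3 := h2.trans (mul_le_mul_of_nonneg_left (norm_sum_matrixUnit_le B) hc)
  rcases (frobNorm_nonneg B).eq_or_lt with h0 | h0
  · rwa [← h0]
  · exact le_of_mul_le_mul_right (by nlinarith) h0

theorem memLp_id_of_memLp_sub {d : ℕ} {π : Measure (EuclideanSpace ℝ (Fin d))}
    [IsFiniteMeasure π] {a : EuclideanSpace ℝ (Fin d)} (hm : MemLp (fun x => x - a) 2 π) :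
    MemLp (fun x => x) 2 π := by
  have e : (fun x => x) = (fun x => x - a) + fun _ => a := by ext1 x; simp
  rw [e]
  exact hm.add (memLp_const a)

/-! ### Expansions of the stationary moments -/

section Expansion

variable {d : ℕ} {Z : Type*} [MeasurableSpace Z] {P : Measure Z} [IsProbabilityMeasure P]
  {gradF : EuclideanSpace ℝ (Fin d) → Z → EuclideanSpace ℝ (Fin d)}
  {g : EuclideanSpace ℝ (Fin d) → EuclideanSpace ℝ (Fin d)} {a : EuclideanSpace ℝ (Fin d)}
  {μ L γ : ℝ} {π : Measure (EuclideanSpace ℝ (Fin d))}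

/-- First order expansion of the second moments of a stationary law. -/
theorem CocoerciveNoise.abs_quadraticMean_sub_le (h : CocoerciveNoise P gradF g a μ L)
    (hγL : γ * L ≤ 1 / 2) (hπ : IsStationaryLaw P gradF γ π) (hm : MemLp (fun x => x - a) 2 π)
    {s τ M : ℝ} (hs : 0 < s) (hsγ : s ^ 2 = γ) (hτ : ∫ z, ‖gradF a z‖ ^ 2 ∂P ≤ τ ^ 2)
    (h2 : ∫ x, ‖x - a‖ ^ 2 ∂π ≤ s ^ 2 * M) (hi : Integrable (fun x => ‖x - a‖ ^ 3) π)
    (h3 : ∫ x, ‖x - a‖ ^ 3 ∂π ≤ s ^ 3 * M)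
    {H : EuclideanSpace ℝ (Fin d) →L[ℝ] EuclideanSpace ℝ (Fin d)}
    (hH : ∀ x, ‖g (a + x) - H x‖ ≤ L * ‖x‖ ^ 2)
    {A G : EuclideanSpace ℝ (Fin d) →L[ℝ] EuclideanSpace ℝ (Fin d)}
    (hG : ∀ x, inner ℝ (H x) (G x) + inner ℝ x (G (H x)) = inner ℝ x (A x))
    (hGA : 2 * μ * ‖G‖ ≤ ‖A‖) :
    |quadraticMean hm A - γ * quadraticMean h.memLp G| ≤
      1 / (2 * μ) * (2 * L * M + M * L ^ 2 * (2 + 1 / L) + τ ^ 2) * s ^ 3 * ‖A‖ := by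
  have := hπ.1
  have hμ := h.mu_pos
  have hL := h.L_pos
  have hγ : 0 < γ := by rw [← hsγ]; positivity
  have hmx : MemLp (fun x => x) 2 π := memLp_id_of_memLp_sub hm
  have hM : 0 ≤ M := by
    have : 0 ≤ s ^ 2 * M := (integral_nonneg fun x => by positivity).trans h2
    exact nonneg_of_mul_nonneg_right this (by positivity)
  have hHm := H.comp_memLp' hm
  have hgm := h.memLp_mean hmx
  have i1 := (hHm.sub hgm).integrable_inner_of_two (G.comp_memLp' hm)
  have i2 := hm.integrable_inner_of_two (G.comp_memLp' (hHm.sub hgm))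
  have i3 := hgm.integrable_inner_of_two (G.comp_memLp' hm)
  have i4 := hm.integrable_inner_of_two (G.comp_memLp' hgm)
  simp only [Function.comp_apply, Pi.sub_apply] at i1 i2 i3 i4
  -- The Lyapunov equation rewrites `⟨x, A x⟩` through `H x`; exchanging `H x` for the gradient
  -- costs a cubic term and leaves the left side of the stationarity identity.
  have e1 : quadraticMean hm A = ∫ x, (inner ℝ (H (x - a) - g x) (G (x - a)) +
      inner ℝ (x - a) (G (H (x - a) - g x))) ∂π +
      γ * ∫ p, inner ℝ (gradF p.1 p.2) (G (gradF p.1 p.2)) ∂(π.prod P) := by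
    rw [← h.integral_quadratic hγ hπ hmx G]
    refine Eq.trans ?_ (integral_add (i1.add i2) (i3.add i4))
    refine integral_congr_ae (Filter.Eventually.of_forall fun x => ?_)
    have e := hG (x - a)
    change inner ℝ (x - a) (A (x - a)) = _
    simp only
    generalize x - a = y at e ⊢
    rw [← e, inner_sub_left, map_sub, inner_sub_right]
    ring
  have b1 : |∫ x, (inner ℝ (H (x - a) - g x) (G (x - a)) +
      inner ℝ (x - a) (G (H (x - a) - g x))) ∂π| ≤ ‖G‖ * (2 * L * M) * s ^ 3 := by
    refine abs_integral_le_integral_abs.trans ?_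
    calc _ ≤ ∫ x, ‖G‖ * (2 * L) * ‖x - a‖ ^ 3 ∂π := by
          refine integral_mono (i1.add i2).abs (hi.const_mul _) fun x => ?_
          have h4 := hH (x - a)
          rw [add_sub_cancel, norm_sub_rev] at h4
          have h5 := abs_inner_apply_le G (H (x - a) - g x) (x - a)
          have h6 := abs_inner_apply_le G (x - a) (H (x - a) - g x)
          calc _ ≤ _ := abs_add_le _ _
            _ ≤ ‖G‖ * (2 * (‖H (x - a) - g x‖ * ‖x - a‖)) := by linarith
            _ ≤ ‖G‖ * (2 * (L * ‖x - a‖ ^ 2 * ‖x - a‖)) := by gcongr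
            _ = _ := by ring
      _ = ‖G‖ * (2 * L) * ∫ x, ‖x - a‖ ^ 3 ∂π := integral_const_mul _ _
      _ ≤ ‖G‖ * (2 * L) * (s ^ 3 * M) := by gcongr
      _ = _ := by ring
  have b2 : |γ * ∫ p, inner ℝ (gradF p.1 p.2) (G (gradF p.1 p.2)) ∂(π.prod P) -
      γ * quadraticMean h.memLp G| ≤ ‖G‖ * (M * L ^ 2 * (2 + 1 / L) + τ ^ 2) * s ^ 3 := by
    have h4 := h.abs_integral_quadratic_sub_le hmx G hs hτ
    -- Replaces the remaining factor `s` by a bound free of `γ`, so that the constant is too.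
    have hs1 : s ≤ 1 + 1 / L := by
      have h5 : s ^ 2 ≤ 1 / L := by
        rw [hsγ, le_div_iff₀ hL]; linarith
      nlinarith [sq_nonneg (s - 1)]
    rw [← mul_sub, abs_mul, abs_of_pos hγ]
    calc _ ≤ γ * (‖G‖ * ((1 + 1 / s) * (L ^ 2 * (s ^ 2 * M)) + s * τ ^ 2)) := by
          refine mul_le_mul_of_nonneg_left (h4.trans ?_) hγ.le
          gcongr
      _ = ‖G‖ * (M * L ^ 2 * (1 + s) + τ ^ 2) * s ^ 3 := by
          rw [← hsγ]; field_simp; ring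
      _ ≤ ‖G‖ * (M * L ^ 2 * (1 + (1 + 1 / L)) + τ ^ 2) * s ^ 3 := by gcongr
      _ = _ := by ring
  have hGn : ‖G‖ ≤ 1 / (2 * μ) * ‖A‖ := by
    rw [one_div, ← div_eq_inv_mul, le_div_iff₀ (by positivity)]
    linarith
  rw [e1, add_sub_assoc]
  calc _ ≤ _ := abs_add_le _ _
    _ ≤ ‖G‖ * (2 * L * M) * s ^ 3 + ‖G‖ * (M * L ^ 2 * (2 + 1 / L) + τ ^ 2) * s ^ 3 :=
        add_le_add b1 b2
    _ = ‖G‖ * ((2 * L * M + M * L ^ 2 * (2 + 1 / L) + τ ^ 2) * s ^ 3) := by ring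
    _ ≤ 1 / (2 * μ) * ‖A‖ * ((2 * L * M + M * L ^ 2 * (2 + 1 / L) + τ ^ 2) * s ^ 3) := by gcongr
    _ = _ := by ring

/-- First order expansion of the mean of a stationary law. -/
theorem CocoerciveNoise.norm_integral_sub_sub_le (h : CocoerciveNoise P gradF g a μ L)
    (hγ : 0 < γ) (hπ : IsStationaryLaw P gradF γ π) (hm : MemLp (fun x => x - a) 2 π)
    {s M K : ℝ} (hs : 0 < s) (hK : 0 ≤ K) (hi : Integrable (fun x => ‖x - a‖ ^ 3) π)
    (h3 : ∫ x, ‖x - a‖ ^ 3 ∂π ≤ s ^ 3 * M)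
    {H : EuclideanSpace ℝ (Fin d) →L[ℝ] EuclideanSpace ℝ (Fin d)}
    (hH : ∀ x, μ * ‖x‖ ^ 2 ≤ inner ℝ (H x) x)
    {A : EuclideanSpace ℝ (Fin d) →ₗ[ℝ]
      (EuclideanSpace ℝ (Fin d) →L[ℝ] EuclideanSpace ℝ (Fin d))}
    (hA : ∀ u, ‖A u‖ ≤ L * ‖u‖)
    (hHA : ∀ x u, |inner ℝ (g (a + x) - H x) u - 1 / 2 * inner ℝ x (A u x)| ≤
      L * ‖x‖ ^ 3 * ‖u‖)
    {Φ : (EuclideanSpace ℝ (Fin d) →L[ℝ] EuclideanSpace ℝ (Fin d)) →ₗ[ℝ] ℝ}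
    (hΦ : ∀ B, |quadraticMean hm B - γ * Φ B| ≤ K * s ^ 3 * ‖B‖)
    {Δ : EuclideanSpace ℝ (Fin d)} (hΔ : ∀ u, inner ℝ (H Δ) u = -(1 / 2) * Φ (A u)) :
    ‖∫ x, (x - a) ∂π - γ • Δ‖ ≤ (L * K / 2 + L * M) / μ * s ^ 3 := by
  have := hπ.1
  have hμ := h.mu_pos
  have hL := h.L_pos
  have hmx : MemLp (fun x => x) 2 π := memLp_id_of_memLp_sub hm
  have hgm := h.memLp_mean hmx
  -- The error is tested against itself: coercivity bounds `μ ‖e‖²` by a multiple of `s³ ‖e‖`,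
  -- without any choice of coordinates.
  set e := ∫ x, (x - a) ∂π - γ • Δ with he
  have hHm := H.comp_memLp' hm
  have hgi := hgm.integrable one_le_two
  have hHi := hHm.integrable one_le_two
  simp only [Function.comp_def] at hHi hHm
  have i1 : Integrable (fun x => inner ℝ (g x - H (x - a)) e) π := (hgi.sub hHi).inner_const e
  have i2 : Integrable (fun x => inner ℝ (x - a) (A e (x - a))) π :=
    hm.integrable_inner_of_two ((A e).comp_memLp' hm)
  have h4 : inner ℝ (H (∫ x, (x - a) ∂π)) e = -∫ x, inner ℝ (g x - H (x - a)) e ∂π := by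
    rw [← ContinuousLinearMap.integral_comp_comm H (hm.integrable one_le_two)]
    simp_rw [fun x => real_inner_comm e (g x - H (x - a))]
    have e1 := integral_inner (𝕜 := ℝ) (hgi.sub hHi) e
    simp only [Pi.sub_apply] at e1
    rw [e1, integral_sub hgi hHi, h.integral_mean_eq_zero hγ hπ hmx,
      zero_sub, inner_neg_right, neg_neg, real_inner_comm]
  have h5 : |∫ x, inner ℝ (g x - H (x - a)) e ∂π - 1 / 2 * quadraticMean hm (A e)| ≤
      L * M * s ^ 3 * ‖e‖ := by
    have e1 : quadraticMean hm (A e) = ∫ x, inner ℝ (x - a) (A e (x - a)) ∂π := rfl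
    rw [e1, ← integral_const_mul, ← integral_sub i1 (i2.const_mul _)]
    refine abs_integral_le_integral_abs.trans ?_
    calc _ ≤ ∫ x, L * ‖e‖ * ‖x - a‖ ^ 3 ∂π := by
          refine integral_mono (i1.sub (i2.const_mul _)).abs (hi.const_mul _) fun x => ?_
          have := hHA (x - a) e
          rw [add_sub_cancel] at this
          refine this.trans (le_of_eq ?_)
          ring
      _ = L * ‖e‖ * ∫ x, ‖x - a‖ ^ 3 ∂π := integral_const_mul _ _
      _ ≤ L * ‖e‖ * (s ^ 3 * M) := by gcongr
      _ = _ := by ring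
  have h6 : inner ℝ (H e) e = -(∫ x, inner ℝ (g x - H (x - a)) e ∂π -
      1 / 2 * quadraticMean hm (A e)) - 1 / 2 * (quadraticMean hm (A e) - γ * Φ (A e)) := by
    have e1 : H e = H (∫ x, (x - a) ∂π) - γ • H Δ := by rw [he, map_sub, map_smul]
    rw [e1, inner_sub_left, h4, inner_smul_left, hΔ]
    simp only [conj_trivial]
    ring
  have h7 : |quadraticMean hm (A e) - γ * Φ (A e)| ≤ K * s ^ 3 * (L * ‖e‖) :=
    (hΦ _).trans (mul_le_mul_of_nonneg_left (hA e) (by positivity))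
  have h8 := hH e
  rw [h6] at h8
  have h9 : μ * ‖e‖ ^ 2 ≤ (L * K / 2 + L * M) * s ^ 3 * ‖e‖ := by
    have := neg_abs_le (∫ x, inner ℝ (g x - H (x - a)) e ∂π - 1 / 2 * quadraticMean hm (A e))
    have := neg_abs_le (quadraticMean hm (A e) - γ * Φ (A e))
    linarith
  rw [div_mul_eq_mul_div, le_div_iff₀ hμ]
  rcases (norm_nonneg e).eq_or_lt with h0 | h0
  · have hM : 0 ≤ s ^ 3 * M := (integral_nonneg fun x => by positivity).trans h3
    rw [← h0, zero_mul]
    have : 0 ≤ L * (K / 2 * s ^ 3 + s ^ 3 * M) := by positivity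
    linarith
  · exact le_of_mul_le_mul_right (by nlinarith) h0

/-! ### Bias of the averaged iterate -/

/-- Sums of powers over the averaging window. -/
theorem sum_Icc_sqrt_pow_le {x : ℝ} (hx : 0 < x) {n : ℕ} (hn : 1 ≤ n) :
    ∑ k ∈ Finset.Icc (n + 1) (2 * n), √(1 - x) ^ k ≤
      2 * (Real.exp (-(x * (n + 1) / 2)) / x) := by
  rcases le_total 1 x with h1 | h1
  · rw [Real.sqrt_eq_zero_of_nonpos (by linarith)]
    refine le_trans (le_of_eq ?_) (by positivity : (0 : ℝ) ≤ _)
    refine Finset.sum_eq_zero fun k hk => zero_pow ?_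
    have := (Finset.mem_Icc.1 hk).1
    omega
  · have hI : Finset.Icc (n + 1) (2 * n) = Finset.Ico (n + 1) (2 * n + 1) := by
      ext k; simp only [Finset.mem_Icc, Finset.mem_Ico]; omega
    rw [hI]
    refine (geom_sum_Ico_le_of_lt_one (Real.sqrt_nonneg _) (sqrt_one_sub_lt_one hx)).trans ?_
    -- Used twice: it bounds the denominator of the geometric sum below by `x / 2`, and with `1 - x
    -- / 2 ≤ exp(-x / 2)` it gives the exponential rate.
    have h2 : √(1 - x) ≤ 1 - x / 2 := by
      rw [Real.sqrt_le_left (by linarith)]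
      nlinarith [sq_nonneg x]
    have h3 : √(1 - x) ^ (n + 1) ≤ Real.exp (-(x * (n + 1) / 2)) := by
      have h4 : √(1 - x) ≤ Real.exp (-(x / 2)) := by
        have := Real.add_one_le_exp (-(x / 2))
        linarith
      refine (pow_le_pow_left₀ (Real.sqrt_nonneg _) h4 _).trans (le_of_eq ?_)
      rw [← Real.exp_nat_mul]
      congr 1
      push_cast
      ring
    calc _ ≤ Real.exp (-(x * (n + 1) / 2)) / (x / 2) := by
          gcongr
          linarith
      _ = _ := by field_simp

/-- The bias of the averaged iterate, relative to the stationary mean. -/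
theorem CocoerciveNoise.polyakRuppert_bound (h : CocoerciveNoise P gradF g a μ L) (hγ : 0 < γ)
    (hγL : γ * L ≤ 1 / 2) (hπ : IsStationaryLaw P gradF γ π) (hm : MemLp (fun x => x) 2 π)
    {τ : ℝ} (hτ0 : 0 ≤ τ) (hτ : ∫ z, ‖gradF a z‖ ^ 2 ∂P ≤ τ ^ 2)
    {ν : Measure (EuclideanSpace ℝ (Fin d))} [IsProbabilityMeasure ν]
    (hν : MemLp (fun x => x) 2 ν) {n : ℕ} (hn : 1 ≤ n) :
    Integrable (polyakRuppert gradF γ n) (sgdLaw P ν) ∧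
    ‖∫ ω, polyakRuppert gradF γ n ω ∂(sgdLaw P ν) - ∫ x, x ∂π‖ ≤
      4 * (Real.exp (-(γ * μ * (n + 1) / 2)) / (n * γ * μ) *
        (√(∫ x, ‖x - a‖ ^ 2 ∂ν) + √γ * τ / √μ)) := by
  have := hπ.1
  have hμ := h.mu_pos
  have hn0 : (0 : ℝ) < n := by exact_mod_cast hn
  have hi : ∀ k, Integrable (sgdIterate gradF γ k) (sgdLaw P ν) :=
    h.integrable_sgdIterate hγ hγL hν
  refine ⟨(integrable_finsetSum _ fun k _ => hi k).smul (n : ℝ)⁻¹, ?_⟩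
  set W := √(∫ x, ‖x - a‖ ^ 2 ∂ν) + √(∫ x, ‖x - a‖ ^ 2 ∂π) with hW
  -- The final constant 4 is this factor 2, which rounds up `√2`, times the factor 2 from the
  -- geometric sum.
  have hW2 : W ≤ 2 * (√(∫ x, ‖x - a‖ ^ 2 ∂ν) + √γ * τ / √μ) := by
    have h1 : √(∫ x, ‖x - a‖ ^ 2 ∂π) ≤ 2 * (√γ * τ / √μ) := by
      rw [Real.sqrt_le_left (by positivity)]
      refine (h.integral_norm_sub_sq_stationary_le hγ hγL hπ hm hτ).trans ?_
      rw [mul_pow, div_pow, mul_pow, Real.sq_sqrt hγ.le, Real.sq_sqrt hμ.le, mul_assoc,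
        mul_div_assoc]
      have : 0 ≤ γ * τ ^ 2 / μ := by positivity
      linarith
    have := Real.sqrt_nonneg (∫ x, ‖x - a‖ ^ 2 ∂ν)
    linarith
  have e : ∫ ω, polyakRuppert gradF γ n ω ∂(sgdLaw P ν) - ∫ x, x ∂π =
      (n : ℝ)⁻¹ • ∑ k ∈ Finset.Icc (n + 1) (2 * n),
        (∫ ω, sgdIterate gradF γ k ω ∂(sgdLaw P ν) - ∫ x, x ∂π) := by
    simp only [polyakRuppert]
    rw [integral_smul, integral_finsetSum _ fun k _ => hi k, Finset.sum_sub_distrib,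
      Finset.sum_const, Nat.card_Icc, show 2 * n + 1 - (n + 1) = n by omega, smul_sub,
      ← Nat.cast_smul_eq_nsmul ℝ, smul_smul, inv_mul_cancel₀ hn0.ne', one_smul]
  rw [e, norm_smul, Real.norm_eq_abs, abs_of_pos (inv_pos.2 hn0)]
  calc _ ≤ (n : ℝ)⁻¹ * ∑ k ∈ Finset.Icc (n + 1) (2 * n), √(1 - γ * μ) ^ k * W := by
        gcongr
        exact (norm_sum_le _ _).trans (Finset.sum_le_sum fun k _ =>
          h.norm_integral_sgdIterate_sub_le hγ hγL hπ hm hν k)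
    _ ≤ (n : ℝ)⁻¹ * (2 * (Real.exp (-(γ * μ * (n + 1) / 2)) / (γ * μ)) *
          (2 * (√(∫ x, ‖x - a‖ ^ 2 ∂ν) + √γ * τ / √μ))) := by
        rw [← Finset.sum_mul]
        gcongr
        exact sum_Icc_sqrt_pow_le (mul_pos hγ hμ) hn
    _ = _ := by field_simp; ring

end Expansion

/-! ### Sixth moment control and assembly -/

theorem MeasureTheory.MemLp.integral_norm_sq_le {Ω V : Type*} [MeasurableSpace Ω]
    [NormedAddCommGroup V] {m : Measure Ω} {X : Ω → V} (hX : MemLp X 2 m) {τ : ℝ} (hτ : 0 ≤ τ)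
    (h : eLpNorm X 2 m ≤ ENNReal.ofReal τ) : ∫ ω, ‖X ω‖ ^ 2 ∂m ≤ τ ^ 2 := by
  rw [hX.eLpNorm_two_eq_sqrt, ENNReal.ofReal_le_ofReal_iff hτ, Real.sqrt_le_left hτ] at h
  exact h

/-- Moments of order at most six, from a bound on the sixth moment at scale `s`. -/
theorem integral_norm_pow_le_of_eLpNorm_six {Ω V : Type*} [MeasurableSpace Ω]
    [NormedAddCommGroup V] {m : Measure Ω} [IsProbabilityMeasure m] {X : Ω → V}
    (hX : MemLp X 6 m) {s κ : ℝ} (hs : 0 < s) (hκ : 0 ≤ κ)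
    (h : eLpNorm X 6 m ^ 2 ≤ ENNReal.ofReal (κ * s ^ 2)) {k : ℕ} (hk : k ≤ 6) :
    Integrable (fun ω => ‖X ω‖ ^ k) m ∧ ∫ ω, ‖X ω‖ ^ k ∂m ≤ s ^ k * (1 + κ ^ 3) := by
  have h6 : Integrable (fun ω => ‖X ω‖ ^ 6) m := by
    have := MemLp.integrable_norm_pow (p := 6) (f := X) (μ := m) (by exact_mod_cast hX)
      (by norm_num)
    exact this
  have hb : ∫ ω, ‖X ω‖ ^ 6 ∂m ≤ κ ^ 3 * s ^ 6 := by
    rw [← ENNReal.ofReal_le_ofReal_iff (by positivity),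
      ofReal_integral_eq_lintegral_ofReal h6 (Filter.Eventually.of_forall fun _ => by positivity)]
    have e1 : ∀ ω, ENNReal.ofReal (‖X ω‖ ^ 6) = ‖X ω‖ₑ ^ 6 := fun ω => by
      rw [ENNReal.ofReal_pow (norm_nonneg _), ofReal_norm]
    have e2 : ∫⁻ ω, ‖X ω‖ₑ ^ 6 ∂m = (eLpNorm X 6 m ^ 2) ^ 3 := by
      rw [← pow_mul]
      exact_mod_cast (eLpNorm_natCast_pow_eq_lintegral m X (n := 6) (by norm_num)).symm
    simp_rw [e1]
    rw [e2]
    refine (pow_le_pow_left₀ zero_le h 3).trans (le_of_eq ?_)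
    rw [← ENNReal.ofReal_pow (by positivity)]
    congr 1
    ring
  have hk' : Integrable (fun ω => s ^ k * (1 + ‖X ω‖ ^ 6 / s ^ 6)) m :=
    ((integrable_const (1 : ℝ)).add (h6.div_const _)).const_mul _
  have hpt : ∀ ω, ‖X ω‖ ^ k ≤ s ^ k * (1 + ‖X ω‖ ^ 6 / s ^ 6) := fun ω =>
    pow_le_of_sixth hs (norm_nonneg _) hk
  have hi : Integrable (fun ω => ‖X ω‖ ^ k) m :=
    hk'.mono' (hX.1.norm.pow k) (Filter.Eventually.of_forall fun ω => by
      rw [Real.norm_eq_abs, abs_of_nonneg (by positivity)]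
      exact hpt ω)
  refine ⟨hi, (integral_mono hi hk' hpt).trans ?_⟩
  rw [integral_const_mul, integral_add (integrable_const _) (h6.div_const _), integral_div]
  simp only [integral_const, probReal_univ, smul_eq_mul, one_mul]
  gcongr
  rw [div_le_iff₀ (by positivity)]
  exact hb

theorem rpow_three_halves {x : ℝ} (hx : 0 ≤ x) : x ^ (3 / 2 : ℝ) = √x ^ 3 := by
  rw [Real.sqrt_eq_rpow, ← Real.rpow_natCast, ← Real.rpow_mul hx]
  norm_num

/-- A vector with prescribed image under a coercive operator, in weak form. -/
theorem exists_inner_apply_eq {E : Type*} [NormedAddCommGroup E] [InnerProductSpace ℝ E]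
    [FiniteDimensional ℝ E] {H : E →L[ℝ] E} {μ : ℝ} (hμ : 0 < μ)
    (hH : ∀ x, μ * ‖x‖ ^ 2 ≤ inner ℝ (H x) x) (l : E →ₗ[ℝ] ℝ) :
    ∃ Δ, ∀ u, inner ℝ (H Δ) u = l u := by
  obtain ⟨R, hR⟩ := exists_riesz E
  have hinj : Function.Injective (H : E →ₗ[ℝ] E) := by
    refine (injective_iff_map_eq_zero _).2 fun x hx => ?_
    have hx' : H x = 0 := hx
    have h1 := hH x
    rw [hx', inner_zero_left] at h1
    have h2 : ‖x‖ ^ 2 ≤ 0 := nonpos_of_mul_nonpos_right h1 hμ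
    exact norm_eq_zero.1 (pow_eq_zero_iff two_ne_zero |>.1 (le_antisymm h2 (sq_nonneg _)))
  obtain ⟨Δ, hΔ⟩ := LinearMap.injective_iff_surjective.1 hinj (R (LinearMap.toContinuousLinearMap l))
  refine ⟨Δ, fun u => ?_⟩
  have hΔ' : H Δ = R (LinearMap.toContinuousLinearMap l) := hΔ
  rw [hΔ', hR]
  rfl

theorem NoiseCondition.cocoerciveNoise {d : ℕ} {Z : Type*} [MeasurableSpace Z] {P : Measure Z}
    [IsProbabilityMeasure P] {f : EuclideanSpace ℝ (Fin d) → ℝ}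
    {gradF : EuclideanSpace ℝ (Fin d) → Z → EuclideanSpace ℝ (Fin d)}
    {θstar : EuclideanSpace ℝ (Fin d)} {μ L L₁ L₂ L₃ L₄ τ : ℝ} (hmin : ∀ θ, f θstar ≤ f θ)
    (hc : StrongConvexity f μ) (hs : Smoothness f L₂ L₃ L₄)
    (hn : NoiseCondition P gradF f θstar 6 L₁ τ) (h₁ : L₁ ≤ L) (h₂ : L₂ ≤ L) :
    CocoerciveNoise P gradF (∇ f) θstar μ L where
  measurable := hn.measurable
  integrable := hn.integrable
  unbiased := hn.unbiased
  memLp := by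
    have h6 : MemLp (gradF θstar) (6 : ℕ) P :=
      ⟨(hn.integrable θstar).aestronglyMeasurable,
        hn.moment_bound.2.trans_lt ENNReal.ofReal_lt_top⟩
    exact h6.mono_exponent (by norm_num)
  zero := gradient_eq_zero_of_forall_le hmin
  mu_pos := hc.mu_pos
  L_pos := hn.L₁_pos.trans_le h₁
  lipschitz x y := (hs.lipschitz x y).trans (mul_le_mul_of_nonneg_right h₂ (norm_nonneg _))
  strongly_monotone := hc.inner_gradient_sub
  cocoercive x y := by
    refine (hn.cocoercive 2 le_rfl (by norm_num) x y).trans (ENNReal.ofReal_le_ofReal ?_)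
    have h0 : 0 ≤ inner ℝ (∇ f x - ∇ f y) (x - y) :=
      (mul_nonneg hc.mu_pos.le (sq_nonneg _)).trans (hc.inner_gradient_sub x y)
    simpa using mul_le_mul_of_nonneg_right h₁ h0

theorem mainTheorem9 :
    ∃ (c : ℝ) (K : ℝ → ℝ → ℝ → ℝ → ℝ),
    ∀ (d : ℕ) (Z : Type*) [MeasurableSpace Z] (P : Measure Z) [IsProbabilityMeasure P]
      (f : EuclideanSpace ℝ (Fin d) → ℝ)
      (gradF : EuclideanSpace ℝ (Fin d) → Z → EuclideanSpace ℝ (Fin d))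
      (θstar : EuclideanSpace ℝ (Fin d))
      (μ L L₁ L₂ L₃ L₄ τ₂ τ₆ C₆ D₆ : ℝ),
      (∀ θ, f θstar ≤ f θ) →
      StrongConvexity f μ →
      Smoothness f L₂ L₃ L₄ →
      NoiseCondition P gradF f θstar 6 L₁ τ₆ →
      OptimumNoiseBound P gradF θstar 2 τ₂ →
      L = max (max L₁ L₂) (max L₃ L₄) →
      MomentCondition P gradF θstar 6 L μ τ₆ C₆ D₆ →
      ∃ (Δ₁ : EuclideanSpace ℝ (Fin d)) (Δ₂ : Matrix (Fin d) (Fin d) ℝ),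
      ∀ γ : ℝ, 0 < γ → γ ≤ 1 / (L * D₆) →
        (∃! π : Measure (EuclideanSpace ℝ (Fin d)), IsStationaryLaw P gradF γ π) ∧
        ∀ π : Measure (EuclideanSpace ℝ (Fin d)), IsStationaryLaw P gradF γ π →
          MemLp (fun θ => θ) 2 π ∧
          ∃ (B₁ : EuclideanSpace ℝ (Fin d)) (B₂ : Matrix (Fin d) (Fin d) ℝ),
            ‖B₁‖ ≤ K L μ τ₆ C₆ ∧
            frobNorm B₂ ≤ K L μ τ₆ C₆ ∧
            ∫ θ, θ ∂π = θstar + γ • Δ₁ + γ ^ (3 / 2 : ℝ) • B₁ ∧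
            secondMomentMatrix θstar π = γ • Δ₂ + γ ^ (3 / 2 : ℝ) • B₂ ∧
            ∀ ν : Measure (EuclideanSpace ℝ (Fin d)), IsProbabilityMeasure ν →
              MemLp (fun θ => θ) 2 ν →
              ∀ n : ℕ, 1 ≤ n →
                Integrable (polyakRuppert gradF γ n) (sgdLaw P ν) ∧
                ∃ R₁ : EuclideanSpace ℝ (Fin d),
                  ∫ ω, polyakRuppert gradF γ n ω ∂(sgdLaw P ν) =
                    θstar + γ • Δ₁ + γ ^ (3 / 2 : ℝ) • B₁ + R₁ ∧
                  ‖R₁‖ ≤ c * (Real.exp (-(γ * μ * (n + 1) / 2)) / (n * γ * μ) *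
                    (Real.sqrt (∫ θ, ‖θ - θstar‖ ^ 2 ∂ν) + Real.sqrt γ * τ₂ / Real.sqrt μ)) := by
  -- `M` bounds the stationary moments of orders 2 and 3 in units of `s ^ k`; `K₂` and `K₁` are the
  -- constants of the expansions of the second moments and of the mean.
  let M : ℝ → ℝ → ℝ → ℝ := fun μ τ C => 1 + (C * τ ^ 2 / μ) ^ 3
  let K₂ : ℝ → ℝ → ℝ → ℝ → ℝ := fun L μ τ C =>
    1 / (2 * μ) * (2 * L * M μ τ C + M μ τ C * L ^ 2 * (2 + 1 / L) + τ ^ 2)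
  let K₁ : ℝ → ℝ → ℝ → ℝ → ℝ := fun L μ τ C => (L * K₂ L μ τ C / 2 + L * M μ τ C) / μ
  refine ⟨4, fun L μ τ C => K₁ L μ τ C + K₂ L μ τ C, ?_⟩
  intro d Z _ P _ f gradF θstar μ L L₁ L₂ L₃ L₄ τ₂ τ₆ C₆ D₆ hmin hc hs hn hτ₂ hLdef hM
  have h₁ : L₁ ≤ L := hLdef ▸ (le_max_left _ _).trans (le_max_left _ _)
  have h₂ : L₂ ≤ L := hLdef ▸ (le_max_right _ _).trans (le_max_left _ _)
  have h₃ : L₃ ≤ L := hLdef ▸ (le_max_left _ _).trans (le_max_right _ _)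
  have h₄ : L₄ ≤ L := hLdef ▸ (le_max_right _ _).trans (le_max_right _ _)
  have h := hn.cocoerciveNoise hmin hc hs h₁ h₂
  have hμ := h.mu_pos
  have hL := h.L_pos
  have hC := hM.two_le_C
  have hD := hM.two_le_D
  obtain ⟨H, A, hH, hA, hlin, hHA⟩ := exists_gradient_expansion hmin hc.inner_gradient_sub
    hs.contDiff hs.bound_three hs.bound_four
  obtain ⟨G, hG⟩ := exists_lyapunov hμ hH
  have hκ : 0 ≤ C₆ * τ₆ ^ 2 / μ := by positivity
  have hMpos : 0 ≤ M μ τ₆ C₆ := by positivity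
  have hK₂ : 0 ≤ K₂ L μ τ₆ C₆ := by positivity
  have hK₁ : 0 ≤ K₁ L μ τ₆ C₆ := by positivity
  let Φ : (EuclideanSpace ℝ (Fin d) →L[ℝ] EuclideanSpace ℝ (Fin d)) →ₗ[ℝ] ℝ :=
    quadraticMean h.memLp ∘ₗ G
  obtain ⟨Δ₁, hΔ₁⟩ := exists_inner_apply_eq hμ hH ((-(1 / 2 : ℝ)) • (Φ ∘ₗ A))
  have hτ6 : ∫ z, ‖gradF θstar z‖ ^ 2 ∂P ≤ τ₆ ^ 2 := by
    refine h.memLp.integral_norm_sq_le hn.moment_bound.1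
      (le_trans (eLpNorm_le_eLpNorm_of_exponent_le ?_ h.memLp.1) hn.moment_bound.2)
    norm_num
  -- The bound by `τ₆` enters the constants of the expansions, the one by `τ₂` the bound on the
  -- remainder of the averaged iterate.
  have hτ2 : ∫ z, ‖gradF θstar z‖ ^ 2 ∂P ≤ τ₂ ^ 2 :=
    h.memLp.integral_norm_sq_le hτ₂.1 (by exact_mod_cast hτ₂.2)
  refine ⟨Δ₁, Matrix.of fun i j => Φ (matrixUnit i j), fun γ hγ hγD => ?_⟩
  have hγL : γ * L ≤ 1 / 2 := by
    rw [le_div_iff₀ (by positivity)] at hγD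
    nlinarith [mul_le_mul_of_nonneg_left hD (mul_nonneg hγ.le hL.le)]
  set s := √γ with hsdef
  have hs0 : 0 < s := Real.sqrt_pos.2 hγ
  have hs2 : s ^ 2 = γ := Real.sq_sqrt hγ.le
  -- The moment condition covers every stationary law, so uniqueness among laws with finite second
  -- moment is uniqueness among all probability measures.
  have hsb : ∀ π, IsStationaryLaw P gradF γ π →
      MemLp (fun θ => θ - θstar) 6 π ∧
      eLpNorm (fun θ => θ - θstar) 6 π ^ 2 ≤ ENNReal.ofReal (C₆ * τ₆ ^ 2 / μ * s ^ 2) := by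
    intro π hπ
    have h1 : eLpNorm (fun θ => θ - θstar) 6 π ^ 2 ≤
        ENNReal.ofReal (C₆ * τ₆ ^ 2 / μ * s ^ 2) := by
      have := hM.stationary_bound γ hγ hγD π hπ
      rw [hs2, show C₆ * τ₆ ^ 2 / μ * γ = C₆ * γ * τ₆ ^ 2 / μ by ring]
      exact_mod_cast this
    refine ⟨⟨by fun_prop, ?_⟩, h1⟩
    by_contra h2
    rw [not_lt_top_iff.1 h2] at h1
    simp at h1
  have hm2 : ∀ π, IsStationaryLaw P gradF γ π → MemLp (fun θ => θ - θstar) 2 π := fun π hπ => by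
    have := hπ.1
    exact (hsb π hπ).1.mono_exponent (by norm_num)
  have hmx : ∀ π, IsStationaryLaw P gradF γ π → MemLp (fun θ => θ) 2 π := fun π hπ => by
    have := hπ.1
    exact memLp_id_of_memLp_sub (hm2 π hπ)
  refine ⟨?_, fun π hπ => ⟨hmx π hπ, ?_⟩⟩
  · obtain ⟨π, hπ⟩ := h.exists_isStationaryLaw hγ hγL
    exact ⟨π, hπ, fun π' hπ' =>
      h.isStationaryLaw_unique hγ hγL hπ hπ' (hmx π hπ) (hmx π' hπ')⟩
  have hπ1 := hπ.1
  have hm := hm2 π hπ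
  obtain ⟨h6, h6b⟩ := hsb π hπ
  obtain ⟨-, hb2⟩ := integral_norm_pow_le_of_eLpNorm_six h6 hs0 hκ h6b (k := 2) (by norm_num)
  obtain ⟨hi3, hb3⟩ := integral_norm_pow_le_of_eLpNorm_six h6 hs0 hκ h6b (k := 3) (by norm_num)
  have hquad : ∀ B, |quadraticMean hm B - γ * Φ B| ≤ K₂ L μ τ₆ C₆ * s ^ 3 * ‖B‖ := fun B =>
    h.abs_quadraticMean_sub_le hγL hπ hm hs0 hs2 hτ6 hb2 hi3 hb3
      (fun x => (hlin x).trans (mul_le_mul_of_nonneg_right h₃ (by positivity)))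
      (hG B).1 (hG B).2
  have hmean := h.norm_integral_sub_sub_le hγ hπ hm hs0 hK₂ hi3 hb3 hH
    (fun u => (hA u).trans (mul_le_mul_of_nonneg_right h₃ (norm_nonneg _)))
    (fun x u => (hHA x u).trans (by gcongr)) hquad (fun u => hΔ₁ u)
  have hs3 : 0 < s ^ 3 := by positivity
  have hint : ∫ θ, (θ - θstar) ∂π = ∫ θ, θ ∂π - θstar := by
    rw [integral_sub ((hmx π hπ).integrable one_le_two) (integrable_const _)]
    simp
  have hmat : secondMomentMatrix θstar π =
      Matrix.of fun i j => quadraticMean hm (matrixUnit i j) := by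
    ext i j
    refine integral_congr_ae (Filter.Eventually.of_forall fun θ => ?_)
    simp only [inner_matrixUnit]
    rfl
  have hB₂ := frobNorm_matrixUnit_le (quadraticMean hm - γ • Φ) hquad (by positivity)
  rw [rpow_three_halves hγ.le, ← hsdef]
  have hexp : ∫ θ, θ ∂π = θstar + γ • Δ₁ +
      s ^ 3 • (s ^ 3)⁻¹ • (∫ θ, (θ - θstar) ∂π - γ • Δ₁) := by
    rw [smul_inv_smul₀ hs3.ne', hint]
    abel
  -- `B₁` and `B₂` are the rescaled errors, so both expansions hold by construction and only the
  -- norm bounds carry content.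
  refine ⟨(s ^ 3)⁻¹ • (∫ θ, (θ - θstar) ∂π - γ • Δ₁),
    (s ^ 3)⁻¹ • Matrix.of fun i j => (quadraticMean hm - γ • Φ) (matrixUnit i j),
    ?_, ?_, hexp, ?_, fun ν hν hν2 n hn1 => ?_⟩
  · rw [norm_smul, norm_inv, Real.norm_eq_abs, abs_of_pos hs3, inv_mul_le_iff₀ hs3]
    refine hmean.trans ?_
    change K₁ L μ τ₆ C₆ * s ^ 3 ≤ _
    nlinarith
  · rw [frobNorm_smul, abs_inv, abs_of_pos hs3, inv_mul_le_iff₀ hs3]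
    refine hB₂.trans ?_
    nlinarith
  · rw [smul_inv_smul₀ hs3.ne', hmat]
    ext i j
    simp
  · obtain ⟨hint', hbound⟩ := h.polyakRuppert_bound hγ hγL hπ (hmx π hπ) hτ₂.1 hτ2 hν2 hn1
    refine ⟨hint', _, ?_, hbound⟩
    rw [← hexp]
    abel
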